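/- Let $m,k,l$ be integers with $k\ge 1$ and $1\le l\le m-k-1$, and let $c_1\ne 0$ be a real constant. Let $Cl_m$ be the real Clifford algebra generated by $\mathbb R^m$ with $x^2=-\|x\|^2$, let $e_1,\dots,e_m$ be the standard basis of $\mathbb R^m$, let $\mathbb Z^l=\mathbb Ze_1+\cdots+\mathbb Ze_l\subset\mathbb R^m$, and let $\pi_l:\mathbb R^m\to C_l=\mathbb R^m/\mathbb Z^l$ be the projection onto the $l$-cylinder. Put $D_x=\sum_i e_i\partial_{x_i}$, $\Delta_x=\sum_i\partial_{x_i}^2$, $\langle u,D_x\rangle=\sum_i u_i\partial_{x_i}$, $\langle D_u,D_x\rangle=\sum_i\partial_{u_i}\partial_{x_i}$. For $Cl_m$-valued functions of $(x,u)$, $u\in\mathbb R^m$, let, for $k=2n$, $$\mathcal D_{1,2n}=\Delta_x^n-\frac{4n}{m+2n-2}\langle u,D_x\rangle\langle D_u,D_x\rangle\Delta_x^{n-1},$$ and, for $k=2n-1$ (the last term being absent when $n=1$), $$\mathcal D_{1,2n-1}=D_x\Delta_x^{n-1}-\frac{2}{m+2n-2}\,u\,\langle D_u,D_x\rangle\Delta_x^{n-1}-\frac{4n-4}{m+2n-2}\langle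 u,D_x\rangle\langle D_u,D_x\rangle\Delta_x^{n-2}D_x .$$ Let $\mathcal D_{1,k}^{C_l}$ be the operator given by the same formula for functions on $C_l\times\mathbb R^m$, where $\partial_{x_i}$ acts on a function on $C_l$ by differentiating its lift to $\mathbb R^m$. Let $\mathcal P_k$ be the space of $Cl_m$-valued homogeneous polynomials of degree $1$ in $u\in\mathbb R^m$ that are harmonic if $k$ is even and left monogenic ($D_uf=0$) if $k$ is odd. Then $\mathcal P_k$ has a unique reproducing kernel $Z_1(u,v)$, that is, $Z_1(\cdot,v)\in\mathcal P_k$ and $f(v)=\int_{S^{m-1}}\overline{Z_1(u,v)}f(u)\,dS(u)$ for all $f\in\mathcal P_k$ and $v\in\mathbb R^m$, where the bar is Clifford conjugation. Define, for $x\neq0$, $$E_{1,k}(x,u,v)=c_1G_k(x)Z_1\Big(\frac{xux}{\|x\|^2},v\Big),\qquad G_{2n}(x)=\frac1{\|x\|^{m-2n}},\quad G_{2n-1}(x)=\frac{x}{\|x\|^{m-2n+2}} .$$ For all $u,v\in\mathbb R^m$ the following hold. (a) The series $$cot_{l,1,k}(x,u,v)=\sum_{(m_1,\dots,m_l)\in\mathbb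 Z^l}E_{1,k}(x+m_1e_1+\cdots+m_le_l,u,v)$$ converges normally on $\mathbb R^m\setminus\mathbb Z^l$ (on each compact subset it is dominated in norm by a convergent series of constants), hence locally uniformly there. (b) Its sum is $l$-fold periodic: $cot_{l,1,k}(x+\mathbf m,u,v)=cot_{l,1,k}(x,u,v)$ for all $\mathbf m\in\mathbb Z^l$. It is $C^\infty$ in $(x,u)\in(\mathbb R^m\setminus\mathbb Z^l)\times\mathbb R^m$, it belongs to $\mathcal P_k$ as a function of $u$, and $\mathcal D_{1,k}\,cot_{l,1,k}(x,u,v)=0$ for $x\in\mathbb R^m\setminus\mathbb Z^l$. (c) The formula $cot'_{l,1,k}(\pi_l(x),\pi_l(y),u,v)=cot_{l,1,k}(x-y,u,v)$ gives a well-defined function on $(C_l\times C_l)\setminus\{(x',x'):x'\in C_l\}$ (the series at $x-y$ converges whenever $\pi_l(x)\ne\pi_l(y)$), and, with the operator acting in $(x',u)$, $$\mathcal D^{C_l}_{1,k}\,cot'_{l,1,k}(x',y',u,v)=0\qquad(x'\ne y').$$ -/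

import Mathlib

open scoped ContDiff InnerProductSpace

noncomputable section

namespace Cylinder

/-- Euclidean space `ℝ^m`. -/
abbrev E (m : ℕ) := EuclideanSpace ℝ (Fin m)

/-- The standard basis vector `e_i` of `ℝ^m`. -/
def e {m : ℕ} (i : Fin m) : E m := EuclideanSpace.single i 1

/-! ### The Clifford algebra `Cl_m` -/

/-- The quadratic form `x ↦ -‖x‖²` on `ℝ^m`. -/
def negSq (m : ℕ) : QuadraticForm ℝ (E m) := -LinearMap.BilinMap.toQuadraticMap (innerₗ (E m))

theorem negSq_apply {m : ℕ} (x : E m) : negSq m x = -‖x‖ ^ 2 := by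
  simp [negSq, LinearMap.BilinMap.toQuadraticMap_apply]

/-- The real Clifford algebra `Cl_m`, generated by `ℝ^m` with the relation `x² = -‖x‖²`. -/
abbrev Cl (m : ℕ) := CliffordAlgebra (negSq m)

/-- The inclusion `ℝ^m ⊆ Cl_m`. -/
abbrev vec {m : ℕ} (x : E m) : Cl m := CliffordAlgebra.ι (negSq m) x

theorem vec_mul_self {m : ℕ} (x : E m) : vec x * vec x = algebraMap ℝ (Cl m) (-‖x‖ ^ 2) := by
  rw [vec, CliffordAlgebra.ι_sq_scalar, negSq_apply]

instance finite_exteriorAlgebra (m : ℕ) : Module.Finite ℝ (ExteriorAlgebra ℝ (E m)) := by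
  have hbot : ∀ i : ℕ, m < i → (⋀[ℝ]^i (E m)) = ⊥ := by
    intro i hi
    have h := exteriorPower.finrank_eq (R := ℝ) (M := E m) i
    rw [finrank_euclideanSpace_fin, Nat.choose_eq_zero_of_lt hi] at h
    exact Submodule.finrank_eq_zero.mp h
  have htop : (⨆ i : Fin (m + 1), (⋀[ℝ]^(i : ℕ) (E m))) = ⊤ := by
    have h := (DirectSum.Decomposition.isInternal
      (fun i : ℕ => ⋀[ℝ]^i (E m))).submodule_iSup_eq_top
    rw [eq_top_iff, ← h]
    refine iSup_le fun i => ?_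
    by_cases hi : i < m + 1
    · exact le_iSup (fun i : Fin (m + 1) => (⋀[ℝ]^(i : ℕ) (E m))) ⟨i, hi⟩
    · rw [hbot i (by omega)]
      exact bot_le
  refine ⟨?_⟩
  rw [← htop]
  exact Submodule.fg_iSup _ fun i => Module.Finite.iff_fg.mp inferInstance

instance finite_cl (m : ℕ) : Module.Finite ℝ (Cl m) :=
  Module.Finite.equiv (CliffordAlgebra.equivExterior (negSq m)).symm

/-- `Cl_m` is a finite-dimensional real vector space, so all its norms are equivalent; we fix the
sup norm of the coordinates in some basis.  It is used only for notions that do not depend on the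
choice of the norm (convergence, derivatives, integrals). -/
instance normedAddCommGroupCl (m : ℕ) : NormedAddCommGroup (Cl m) :=
  NormedAddCommGroup.induced (Cl m) (Fin (Module.finrank ℝ (Cl m)) → ℝ)
    (Module.finBasis ℝ (Cl m)).equivFun (Module.finBasis ℝ (Cl m)).equivFun.injective

instance normedSpaceCl (m : ℕ) : NormedSpace ℝ (Cl m) :=
  NormedSpace.induced ℝ (Cl m) (Fin (Module.finrank ℝ (Cl m)) → ℝ)
    (Module.finBasis ℝ (Cl m)).equivFun

/-! ### The cylinder `C_l = ℝ^m / ℤ^l` -/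

/-- `(n_1, …, n_l) ↦ n_1 e_1 + ⋯ + n_l e_l` (used for `l ≤ m`). -/
def latticeVec (m l : ℕ) : (Fin l → ℤ) →+ E m where
  toFun n := WithLp.toLp 2 fun j : Fin m => if h : (j : ℕ) < l then (n ⟨j, h⟩ : ℝ) else 0
  map_zero' := by ext j; simp
  map_add' a b := by
    ext j
    by_cases h : (j : ℕ) < l <;> simp [h]

/-- The lattice `ℤ^l = ℤ e_1 + ⋯ + ℤ e_l ⊆ ℝ^m`. -/
def lattice (m l : ℕ) : AddSubgroup (E m) := (latticeVec m l).range

/-- The `l`-cylinder `C_l = ℝ^m / ℤ^l`. -/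
abbrev Cyl (m l : ℕ) := E m ⧸ lattice m l

/-- The projection `π_l : ℝ^m → C_l`. -/
abbrev proj (m l : ℕ) (x : E m) : Cyl m l := QuotientAddGroup.mk x

/-- The function on `C_l` induced by an `l`-fold periodic function on `ℝ^m`. -/
def cylLift {m l : ℕ} {α : Type*} (g : E m → α)
    (hg : ∀ (n : Fin l → ℤ) (x : E m), g (x + latticeVec m l n) = g x) : Cyl m l → α :=
  Quotient.lift g (by
    intro a b hab
    obtain ⟨n, hn⟩ := QuotientAddGroup.leftRel_apply.mp hab
    have hb : b = a + latticeVec m l n := by rw [hn]; abel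
    rw [hb, hg])

/-! ### Differential operators

The operators are written once, for functions `F(x, u)` with `x` in a space `X` (which is `ℝ^m`
or `C_l`) that carries operators `P i`, the partial derivatives with respect to `x_i`. -/

/-- The partial derivative `∂_{x_i}` on `ℝ^m`. -/
def partialE {m : ℕ} (i : Fin m) (g : E m → Cl m) (x : E m) : Cl m := lineDeriv ℝ g x (e i)

theorem partialE_periodic {m l : ℕ} (i : Fin m) (g : Cyl m l → Cl m) (n : Fin l → ℤ) (x : E m) :
    partialE i (fun z => g (proj m l z)) (x + latticeVec m l n) =
      partialE i (fun z => g (proj m l z)) x := by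
  have h : ∀ z : E m, proj m l (z + latticeVec m l n) = proj m l z := fun z =>
    QuotientAddGroup.mk_add_of_mem z ⟨n, rfl⟩
  simp only [partialE, lineDeriv, add_right_comm x (latticeVec m l n), h]

/-- The projection of `∂_{x_i}` to `C_l`: it acts on a function on `C_l` by differentiating its
periodic lift to `ℝ^m`. -/
def partialCyl {m l : ℕ} (i : Fin m) (g : Cyl m l → Cl m) : Cyl m l → Cl m :=
  cylLift (partialE i fun z => g (proj m l z)) (partialE_periodic i g)

section Operators

variable {m : ℕ} {X : Type} (P : Fin m → (X → Cl m) → X → Cl m)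

/-- `∂_{x_i}` on functions of `(x, u)`. -/
def dX (i : Fin m) (F : X → E m → Cl m) : X → E m → Cl m :=
  fun x u => P i (fun z => F z u) x

/-- `∂_{u_i}` on functions of `(x, u)`. -/
def dU (i : Fin m) (F : X → E m → Cl m) : X → E m → Cl m :=
  fun x u => partialE i (F x) u

/-- The Dirac operator `D_x = ∑ e_i ∂_{x_i}`. -/
def diracX (F : X → E m → Cl m) : X → E m → Cl m :=
  fun x u => ∑ i, vec (e i) * dX P i F x u

/-- The Laplace operator `Δ_x = ∑ ∂_{x_i}²`. -/
def laplaceX (F : X → E m → Cl m) : X → E m → Cl m :=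
  fun x u => ∑ i, dX P i (dX P i F) x u

/-- `⟨u, D_x⟩ = ∑ u_i ∂_{x_i}`. -/
def uDX (F : X → E m → Cl m) : X → E m → Cl m :=
  fun x u => ∑ i, u i • dX P i F x u

/-- `⟨D_u, D_x⟩ = ∑ ∂_{u_i} ∂_{x_i}`. -/
def dUdX (F : X → E m → Cl m) : X → E m → Cl m :=
  fun x u => ∑ i, dU i (dX P i F) x u

/-- The bosonic operator of order `2n`, `n ≥ 1`:
`Δ_x^n - 4n/(m+2n-2) ⟨u, D_x⟩ ⟨D_u, D_x⟩ Δ_x^{n-1}`. -/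
def bosonic (n : ℕ) (F : X → E m → Cl m) : X → E m → Cl m :=
  fun x u => (laplaceX P)^[n] F x u
    - (4 * n / (m + 2 * n - 2) : ℝ) • uDX P (dUdX P ((laplaceX P)^[n - 1] F)) x u

/-- The fermionic operator of order `2n-1`, `n ≥ 1`:
`D_x Δ_x^{n-1} - 2/(m+2n-2) u ⟨D_u, D_x⟩ Δ_x^{n-1}
  - (4n-4)/(m+2n-2) ⟨u, D_x⟩ ⟨D_u, D_x⟩ Δ_x^{n-2} D_x`.
For `n = 1` the coefficient of the last term is zero, so that term is absent. -/
def fermionic (n : ℕ) (F : X → E m → Cl m) : X → E m → Cl m :=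
  fun x u => diracX P ((laplaceX P)^[n - 1] F) x u
    - (2 / (m + 2 * n - 2) : ℝ) • (vec u * dUdX P ((laplaceX P)^[n - 1] F) x u)
    - ((4 * n - 4) / (m + 2 * n - 2) : ℝ) •
        uDX P (dUdX P ((laplaceX P)^[n - 2] (diracX P F))) x u

/-- The operator `𝒟_{1,k}`, `k ≥ 1`: bosonic with `k = 2n`, or fermionic with `k = 2n-1`. -/
def higherSpin (k : ℕ) (F : X → E m → Cl m) : X → E m → Cl m :=
  if Even k then bosonic P (k / 2) F else fermionic P ((k + 1) / 2) F

end Operators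

/-- `𝒟_{1,k}` on `ℝ^m`. -/
def opE (m k : ℕ) : (E m → E m → Cl m) → E m → E m → Cl m := higherSpin partialE k

/-- `𝒟_{1,k}^{C_l}` on the cylinder `C_l`: the same expression, with the projections of the
derivatives to `C_l`. -/
def opCyl (m k l : ℕ) : (Cyl m l → E m → Cl m) → Cyl m l → E m → Cl m := higherSpin partialCyl k

/-! ### The reproducing kernel `Z_1` -/

/-- `f : ℝ^m → Cl_m` is a homogeneous polynomial of degree `1`. -/
def IsHomogeneousDegreeOne {m : ℕ} (f : E m → Cl m) : Prop :=
  ∃ a : Fin m → Cl m, ∀ u, f u = ∑ i, u i • a i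

/-- The `Cl_m`-valued homogeneous polynomials of degree `1` that are harmonic (`k` even), resp.
left monogenic (`k` odd). -/
def IsSpinOne {m : ℕ} (k : ℕ) (f : E m → Cl m) : Prop :=
  IsHomogeneousDegreeOne f ∧
    if Even k then ∀ u, ∑ i, partialE i (partialE i f) u = 0
    else ∀ u, ∑ i, vec (e i) * partialE i f u = 0

/-- `Z` is the reproducing kernel of the space of degree `1` polynomials above, for the inner
product `∫_{S^{m-1}} conj(f) g dS`.  Here `star` is Clifford conjugation, the anti-automorphism of
`Cl_m` with `conj(x) = -x` for `x ∈ ℝ^m`, and the measure is surface measure on the sphere. -/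
structure IsReproducingKernel (m k : ℕ) (Z : E m → E m → Cl m) : Prop where
  mem : ∀ v, IsSpinOne k fun u => Z u v
  reproducing : ∀ f : E m → Cl m, IsSpinOne k f → ∀ v,
    ∫ u : Metric.sphere (0 : E m) 1, star (Z u v) * f u
      ∂(MeasureTheory.volume : MeasureTheory.Measure (E m)).toSphere = f v

/-! ### The kernels -/

/-- The vector `x u x / ‖x‖²`, see `vec_sandwich`. -/
def sandwich {m : ℕ} (x u : E m) : E m := u - (2 * ⟪x, u⟫_ℝ / ‖x‖ ^ 2) • x

theorem vec_sandwich {m : ℕ} (x u : E m) (hx : x ≠ 0) :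
    vec (sandwich x u) = (‖x‖ ^ 2)⁻¹ • (vec x * vec u * vec x) := by
  have hn : ‖x‖ ^ 2 ≠ 0 := by simpa using hx
  have hp : QuadraticMap.polar (negSq m) x u = -(2 * ⟪x, u⟫_ℝ) := by
    simp only [QuadraticMap.polar, negSq_apply, norm_add_sq_real]
    ring
  have h := CliffordAlgebra.ι_mul_ι_mul_ι (Q := negSq m) x u
  rw [vec, vec, vec, h, hp, negSq_apply, ← LinearMap.map_smul, sandwich]
  congr 1
  ext i
  simp
  field_simp
  ring

/-- `G_k(x) = ‖x‖^{-(m-2n)}` for `k = 2n`, and `G_k(x) = x ‖x‖^{-(m-2n+2)}` for `k = 2n-1`. -/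
def G (m k : ℕ) (x : E m) : Cl m :=
  if Even k then algebraMap ℝ (Cl m) (‖x‖ ^ ((k : ℤ) - m)) else ‖x‖ ^ ((k : ℤ) - m - 1) • vec x

/-- `E_{1,k}(x,u,v) = c₁ G_k(x) Z_1(xux/‖x‖², v)`. -/
def fundSol (m k : ℕ) (c₁ : ℝ) (Z : E m → E m → Cl m) (x u v : E m) : Cl m :=
  c₁ • (G m k x * Z (sandwich x u) v)

/-- `cot_{l,1,k}(x,u,v) = ∑_{n ∈ ℤ^l} E_{1,k}(x + n_1 e_1 + ⋯ + n_l e_l, u, v)`. -/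
def cot (m k l : ℕ) (c₁ : ℝ) (Z : E m → E m → Cl m) (x u v : E m) : Cl m :=
  ∑' n : Fin l → ℤ, fundSol m k c₁ Z (x + latticeVec m l n) u v

theorem cot_periodic (m k l : ℕ) (c₁ : ℝ) (Z : E m → E m → Cl m) (u v : E m)
    (n : Fin l → ℤ) (x : E m) :
    cot m k l c₁ Z (x + latticeVec m l n) u v = cot m k l c₁ Z x u v := by
  unfold cot
  rw [← (Equiv.addLeft n).tsum_eq fun j => fundSol m k c₁ Z (x + latticeVec m l j) u v]
  simp [add_assoc]

/-- The projected kernel `cot'_{l,1,k}(x',y',u,v)` on `C_l × C_l`; only its values off the diagonal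
are meaningful. -/
def cotCyl (m k l : ℕ) (c₁ : ℝ) (Z : E m → E m → Cl m) (x' y' : Cyl m l) (u v : E m) : Cl m :=
  cylLift (fun x => cot m k l c₁ Z x u v) (cot_periodic m k l c₁ Z u v) (x' - y')

/-- Normal convergence of `∑ f_i` on `Ω`: on each compact `K ⊆ Ω` the series is dominated by a
convergent series of constants. -/
def NormallyConvergentOn {ι X V : Type*} [TopologicalSpace X] [NormedAddCommGroup V]
    (f : ι → X → V) (Ω : Set X) : Prop :=
  ∀ K ⊆ Ω, IsCompact K → ∃ M : ι → ℝ, Summable M ∧ ∀ i, ∀ x ∈ K, ‖f i x‖ ≤ M i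

end Cylinder

end

open Cylinder

/-!
A function `F(x, u)` that is linear in `u` is a linear map `u ↦ F(·, u)` from `ℝ^m` to the module of
smooth functions of `x`, on which `𝒟_{1,k}` is an algebraic expression in the commuting operators
`∂_{x_i}` and the multiplications by `e_i`. For linear `w` with `∑ e_i w(e_i) = 0` when `k` is odd,
the product rule computes the operators on `‖x‖^a w(xux/‖x‖²)` and `x ‖x‖^a w(xux/‖x‖²)`, and the
coefficients of `𝒟_{1,k}` are exactly those for which everything cancels at `a = k - m`, resp.
`a = k - m - 1`, up to terms `‖x‖^{2j-m}` that are killed by the remaining powers of `Δ_x`.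

These functions are homogeneous of degree `k - m < -l`, and their derivatives decay even faster, so
the sum over the translates by a lattice of rank `l` and its formal derivatives converge normally.
Hence periodization commutes with the `∂_{x_i}` and the constant multiplications, thus also with
`𝒟_{1,k}`.

The inner product of two linear functions over the sphere only involves the second moments of the
sphere, which the reflections determine; the reproducing kernel is then the projection of a multiple
of `⟪u, v⟫` to `𝒫_k`.
-/

noncomputable section

namespace Cylinder

open Asymptotics Topology
open Bornology (cobounded)
open TopologicalSpace (Opens)

/-! ### The operators in terms of commuting derivatives -/

/-- Endomorphisms of a real vector space that behave like the partial derivatives `∂_{x_i}` and the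
left multiplications by `e_i` of `Cl_m`-valued functions of `x`. They suffice to express `𝒟_{1,k}`
on functions that are linear in `u`, which are encoded as linear maps from the space `ℝ^m` of the
variable `u` to the vector space. -/
structure DiracSystem (m : ℕ) (N : Type*) [AddCommGroup N] [Module ℝ N] where
  /-- The derivatives `∂_{x_i}`. -/
  deriv : Fin m → Module.End ℝ N
  /-- The multiplications by `e_i`. -/
  mulBasis : Fin m → Module.End ℝ N
  commute_deriv : ∀ i j, Commute (deriv i) (deriv j)
  commute_mulBasis_deriv : ∀ i j, Commute (mulBasis i) (deriv j)

namespace DiracSystem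

variable {m : ℕ} {N N' : Type*} [AddCommGroup N] [Module ℝ N] [AddCommGroup N'] [Module ℝ N']

section Operators

variable (S : DiracSystem m N)

/-- The Laplace operator `Δ_x`. -/
def laplacian : Module.End ℝ N := ∑ i, S.deriv i * S.deriv i

/-- The Dirac operator `D_x`. -/
def dirac : Module.End ℝ N := ∑ i, S.mulBasis i * S.deriv i

/-- The derivative `⟨u, D_x⟩`. -/
def directional (u : E m) : Module.End ℝ N := ∑ i, u i • S.deriv i

/-- Multiplication by the vector `u`. -/
def mulVec (u : E m) : Module.End ℝ N := ∑ i, u i • S.mulBasis i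

/-- The operator `⟨D_u, D_x⟩`, whose values on functions linear in `u` do not depend on `u`. -/
def divergence (b : E m →ₗ[ℝ] N) : N := ∑ i, S.deriv i (b (e i))

/-- The bosonic operator `𝒟_{1,2n}`. -/
def bosonic (n : ℕ) (b : E m →ₗ[ℝ] N) (u : E m) : N :=
  (S.laplacian ^ n) (b u) - (4 * n / (m + 2 * n - 2) : ℝ) •
    S.directional u (S.divergence ((S.laplacian ^ (n - 1)) ∘ₗ b))

/-- The fermionic operator `𝒟_{1,2n-1}`. -/
def fermionic (n : ℕ) (b : E m →ₗ[ℝ] N) (u : E m) : N :=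
  S.dirac ((S.laplacian ^ (n - 1)) (b u))
    - (2 / (m + 2 * n - 2) : ℝ) • S.mulVec u (S.divergence ((S.laplacian ^ (n - 1)) ∘ₗ b))
    - ((4 * n - 4) / (m + 2 * n - 2) : ℝ) •
        S.directional u (S.divergence ((S.laplacian ^ (n - 2)) ∘ₗ S.dirac ∘ₗ b))

/-- The operator `𝒟_{1,k}`. -/
def higherSpin (k : ℕ) (b : E m →ₗ[ℝ] N) (u : E m) : N :=
  if Even k then S.bosonic (k / 2) b u else S.fermionic ((k + 1) / 2) b u

end Operators

section Commutation

variable {S : DiracSystem m N}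

theorem commute_laplacian {T : Module.End ℝ N} (h : ∀ i, Commute T (S.deriv i)) :
    Commute T S.laplacian :=
  Commute.sum_right _ _ _ fun i _ => (h i).mul_right (h i)

theorem divergence_comp {T : Module.End ℝ N} (h : ∀ i, Commute T (S.deriv i))
    (b : E m →ₗ[ℝ] N) : S.divergence (T ∘ₗ b) = T (S.divergence b) := by
  simp only [divergence, map_sum, LinearMap.comp_apply]
  exact Finset.sum_congr rfl fun i _ => (LinearMap.congr_fun (h i) (b (e i))).symm

variable (S)

theorem commute_laplacian_deriv (i : Fin m) : Commute S.laplacian (S.deriv i) :=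
  (commute_laplacian (S.commute_deriv i)).symm

theorem commute_dirac_deriv (i : Fin m) : Commute S.dirac (S.deriv i) :=
  Commute.sum_left _ _ _ fun j _ => (S.commute_mulBasis_deriv j i).mul_left (S.commute_deriv j i)

theorem commute_directional_deriv (u : E m) (i : Fin m) :
    Commute (S.directional u) (S.deriv i) :=
  Commute.sum_left _ _ _ fun j _ => (S.commute_deriv j i).smul_left (u j)

theorem commute_mulVec_deriv (u : E m) (i : Fin m) : Commute (S.mulVec u) (S.deriv i) :=
  Commute.sum_left _ _ _ fun j _ => (S.commute_mulBasis_deriv j i).smul_left (u j)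

theorem bosonic_succ (n : ℕ) (b : E m →ₗ[ℝ] N) (u : E m) :
    S.bosonic (n + 1) b u = (S.laplacian ^ n) (S.laplacian (b u)
      - (4 * (n + 1) / (m + 2 * n) : ℝ) • S.directional u (S.divergence b)) := by
  have hdir := (commute_laplacian (S.commute_directional_deriv u)).pow_right n
  rw [bosonic, Nat.add_sub_cancel,
    divergence_comp fun i => (S.commute_laplacian_deriv i).pow_left n,
    ← Module.End.mul_apply (S.directional u), hdir, Module.End.mul_apply, map_sub, map_smul,
    pow_succ, Module.End.mul_apply]
  congr 3 <;> push_cast <;> ring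

theorem fermionic_one (b : E m →ₗ[ℝ] N) (u : E m) :
    S.fermionic 1 b u = S.dirac (b u) - (2 / m : ℝ) • S.mulVec u (S.divergence b) := by
  rw [fermionic, Nat.sub_self, pow_zero, Module.End.one_eq_id, LinearMap.id_comp]
  norm_num

theorem fermionic_add_two (n : ℕ) (b : E m →ₗ[ℝ] N) (u : E m) :
    S.fermionic (n + 2) b u = (S.laplacian ^ n) (S.laplacian (S.dirac (b u)
        - (2 / (m + 2 * (n + 1)) : ℝ) • S.mulVec u (S.divergence b))
      - (4 * (n + 1) / (m + 2 * (n + 1)) : ℝ) •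
        S.directional u (S.dirac (S.divergence b))) := by
  have hdirac := (commute_laplacian S.commute_dirac_deriv).pow_right (n + 1)
  have hvec := (commute_laplacian (S.commute_mulVec_deriv u)).pow_right (n + 1)
  have hdir := (commute_laplacian (S.commute_directional_deriv u)).pow_right n
  have hdiv (j : ℕ) := divergence_comp fun i => (S.commute_laplacian_deriv i).pow_left j
  rw [fermionic, show n + 2 - 1 = n + 1 from rfl, Nat.add_sub_cancel, hdiv, hdiv,
    divergence_comp S.commute_dirac_deriv, ← Module.End.mul_apply S.dirac, hdirac,
    ← Module.End.mul_apply (S.mulVec u), hvec, ← Module.End.mul_apply (S.directional u), hdir]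
  simp only [Module.End.mul_apply, map_sub, map_smul, pow_succ]
  congr 3 <;> push_cast <;> ring

end Commutation

/-- `T` carries the derivatives and the multiplications of `S` to those of `S'`. -/
structure Intertwines (T : N →ₗ[ℝ] N') (S : DiracSystem m N) (S' : DiracSystem m N') : Prop where
  map_deriv : ∀ i b, T (S.deriv i b) = S'.deriv i (T b)
  map_mulBasis : ∀ i b, T (S.mulBasis i b) = S'.mulBasis i (T b)

namespace Intertwines

variable {S : DiracSystem m N} {S' : DiracSystem m N'} {T : N →ₗ[ℝ] N'}

theorem comp_laplacian_pow (h : Intertwines T S S') (n : ℕ) :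
    T ∘ₗ (S.laplacian ^ n) = (S'.laplacian ^ n) ∘ₗ T := by
  have hlap : T ∘ₗ S.laplacian = S'.laplacian ∘ₗ T := by
    ext b
    simp [laplacian, h.map_deriv]
  exact (Module.End.commute_pow_left_of_commute hlap.symm n).symm

theorem comp_dirac (h : Intertwines T S S') : T ∘ₗ S.dirac = S'.dirac ∘ₗ T := by
  ext b
  simp [dirac, h.map_deriv, h.map_mulBasis]

theorem map_directional (h : Intertwines T S S') (u : E m) (b : N) :
    T (S.directional u b) = S'.directional u (T b) := by
  simp [directional, h.map_deriv]

theorem map_mulVec (h : Intertwines T S S') (u : E m) (b : N) :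
    T (S.mulVec u b) = S'.mulVec u (T b) := by
  simp [mulVec, h.map_mulBasis]

theorem map_divergence (h : Intertwines T S S') (b : E m →ₗ[ℝ] N) :
    T (S.divergence b) = S'.divergence (T ∘ₗ b) := by
  simp [divergence, h.map_deriv]

theorem map_higherSpin (h : Intertwines T S S') (k : ℕ) (b : E m →ₗ[ℝ] N) (u : E m) :
    T (S.higherSpin k b u) = S'.higherSpin k (T ∘ₗ b) u := by
  have hlap (n : ℕ) (b : N) : T ((S.laplacian ^ n) b) = (S'.laplacian ^ n) (T b) :=
    LinearMap.congr_fun (h.comp_laplacian_pow n) b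
  have hdirac (b : N) : T (S.dirac b) = S'.dirac (T b) := LinearMap.congr_fun h.comp_dirac b
  unfold higherSpin bosonic fermionic
  split_ifs <;>
    simp only [map_sub, map_smul, h.map_directional, h.map_mulVec, h.map_divergence, hlap, hdirac,
      LinearMap.comp_apply, ← LinearMap.comp_assoc, h.comp_laplacian_pow]
  simp only [LinearMap.comp_assoc, h.comp_dirac]

end Intertwines

/-- The system induced on an invariant subspace. -/
def restrict (S : DiracSystem m N) (M : Submodule ℝ N) (hderiv : ∀ i, ∀ b ∈ M, S.deriv i b ∈ M)
    (hmul : ∀ i, ∀ b ∈ M, S.mulBasis i b ∈ M) : DiracSystem m M where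
  deriv i := (S.deriv i).restrict (hderiv i)
  mulBasis i := (S.mulBasis i).restrict (hmul i)
  commute_deriv i j := LinearMap.ext fun b =>
    Subtype.ext (LinearMap.congr_fun (S.commute_deriv i j) (b : N))
  commute_mulBasis_deriv i j := LinearMap.ext fun b =>
    Subtype.ext (LinearMap.congr_fun (S.commute_mulBasis_deriv i j) (b : N))

theorem intertwines_subtype_restrict (S : DiracSystem m N) {M : Submodule ℝ N}
    (hderiv : ∀ i, ∀ b ∈ M, S.deriv i b ∈ M) (hmul : ∀ i, ∀ b ∈ M, S.mulBasis i b ∈ M) :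
    Intertwines M.subtype (S.restrict M hderiv hmul) S :=
  ⟨fun _ _ => rfl, fun _ _ => rfl⟩

end DiracSystem

section Naturality

variable {m : ℕ} {X Y : Type} {P : Fin m → (X → Cl m) → X → Cl m}
  {Q : Fin m → (Y → Cl m) → Y → Cl m} {φ : X → Y}

theorem dX_comp (h : ∀ i g x, P i (fun z => g (φ z)) x = Q i g (φ x)) (i : Fin m)
    (F : Y → E m → Cl m) : dX P i (fun x => F (φ x)) = fun x => dX Q i F (φ x) :=
  funext fun x => funext fun u => h i (fun y => F y u) x

theorem laplaceX_iterate_comp (h : ∀ i g x, P i (fun z => g (φ z)) x = Q i g (φ x)) (n : ℕ)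
    (F : Y → E m → Cl m) :
    (laplaceX P)^[n] (fun x => F (φ x)) = fun x => (laplaceX Q)^[n] F (φ x) := by
  have hlap (F : Y → E m → Cl m) :
      laplaceX P (fun x => F (φ x)) = fun x => laplaceX Q F (φ x) := by
    funext x u
    simp only [laplaceX, dX_comp h]
  induction n generalizing F with
  | zero => rfl
  | succ n ih => rw [Function.iterate_succ_apply, hlap, ih, Function.iterate_succ_apply]

theorem higherSpin_comp (h : ∀ i g x, P i (fun z => g (φ z)) x = Q i g (φ x)) (k : ℕ)
    (F : Y → E m → Cl m) (x : X) (u : E m) :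
    higherSpin P k (fun x => F (φ x)) x u = higherSpin Q k F (φ x) u := by
  have hdirac (F : Y → E m → Cl m) : diracX P (fun x => F (φ x)) = fun x => diracX Q F (φ x) := by
    funext x u
    simp only [diracX, dX_comp h]
  have huDX (F : Y → E m → Cl m) : uDX P (fun x => F (φ x)) = fun x => uDX Q F (φ x) := by
    funext x u
    simp only [uDX, dX_comp h]
  have hdUdX (F : Y → E m → Cl m) : dUdX P (fun x => F (φ x)) = fun x => dUdX Q F (φ x) := by
    funext x u
    simp only [dUdX, dU, dX_comp h]
  unfold higherSpin bosonic fermionic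
  split_ifs <;> simp only [hdirac, laplaceX_iterate_comp h, hdUdX, huDX]

end Naturality

theorem opCyl_proj (m k l : ℕ) (F : Cyl m l → E m → Cl m) (x u : E m) :
    opCyl m k l F (proj m l x) u = opE m k (fun z w => F (proj m l z) w) x u :=
  (higherSpin_comp (P := partialE) (Q := partialCyl) (fun _ _ _ => rfl) k F x u).symm

theorem opE_comp_sub (m k : ℕ) (F : E m → E m → Cl m) (x y u : E m) :
    opE m k (fun z w => F (z - y) w) x u = opE m k F (x - y) u := by
  refine higherSpin_comp (φ := fun z => z - y) (fun i g z => ?_) k F x u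
  simp only [partialE, lineDeriv, add_sub_right_comm]

/-! ### Smooth functions on an open set -/

section SmoothFn

variable {X V W : Type*} [NormedAddCommGroup X] [NormedSpace ℝ X] [NormedAddCommGroup V]
  [NormedSpace ℝ V] [NormedAddCommGroup W] [NormedSpace ℝ W]

/-- The `V`-valued smooth functions on the open set `Ω`, encoded as functions on the whole space
that vanish off `Ω`. -/
def SmoothFn (Ω : Opens X) (V : Type*) [NormedAddCommGroup V] [NormedSpace ℝ V] :
    Submodule ℝ (X → V) where
  carrier := {f | ContDiffOn ℝ ∞ f Ω ∧ ∀ x ∉ Ω, f x = 0}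
  add_mem' hf hg := ⟨hf.1.add hg.1, fun x hx => by simp [hf.2 x hx, hg.2 x hx]⟩
  zero_mem' := ⟨contDiffOn_const, fun _ _ => rfl⟩
  smul_mem' c _ hf := ⟨contDiffOn_const.smul hf.1, fun x hx => by simp [hf.2 x hx]⟩

namespace SmoothFn

variable {Ω : Opens X}

instance : CoeFun (SmoothFn Ω V) fun _ => X → V := ⟨Subtype.val⟩

theorem contDiffOn (f : SmoothFn Ω V) : ContDiffOn ℝ ∞ f Ω := f.2.1

theorem contDiffAt (f : SmoothFn Ω V) {x : X} (hx : x ∈ Ω) : ContDiffAt ℝ ∞ f x :=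
  (contDiffOn f).contDiffAt (Ω.isOpen.mem_nhds hx)

theorem differentiableAt (f : SmoothFn Ω V) {x : X} (hx : x ∈ Ω) : DifferentiableAt ℝ f x :=
  (contDiffAt f hx).differentiableAt (by simp)

theorem eq_zero_of_notMem (f : SmoothFn Ω V) {x : X} (hx : x ∉ Ω) : f x = 0 := f.2.2 x hx

theorem ext_on {f g : SmoothFn Ω V} (h : ∀ x ∈ Ω, f x = g x) : f = g := by
  ext x
  by_cases hx : x ∈ Ω
  · exact h x hx
  · rw [eq_zero_of_notMem f hx, eq_zero_of_notMem g hx]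

@[simp]
theorem add_apply (f g : SmoothFn Ω V) (x : X) : (f + g) x = f x + g x := rfl

@[simp]
theorem sub_apply (f g : SmoothFn Ω V) (x : X) : (f - g) x = f x - g x := rfl

@[simp]
theorem neg_apply (f : SmoothFn Ω V) (x : X) : (-f) x = -f x := rfl

@[simp]
theorem smul_apply (c : ℝ) (f : SmoothFn Ω V) (x : X) : (c • f) x = c • f x := rfl

@[simp]
theorem sum_apply {ι : Type*} (s : Finset ι) (f : ι → SmoothFn Ω V) (x : X) :
    (∑ i ∈ s, f i) x = ∑ i ∈ s, f i x := by
  rw [AddSubmonoidClass.coe_finsetSum, Finset.sum_apply]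

/-- The restriction to `Ω` of a function that is smooth there. -/
def ofContDiffOn (f : X → V) (hf : ContDiffOn ℝ ∞ f Ω) : SmoothFn Ω V :=
  ⟨Set.indicator Ω f, hf.congr fun _ hx => Set.indicator_of_mem hx f,
    fun _ hx => Set.indicator_of_notMem hx f⟩

theorem ofContDiffOn_apply {f : X → V} (hf : ContDiffOn ℝ ∞ f Ω) {x : X} (hx : x ∈ Ω) :
    ofContDiffOn f hf x = f x :=
  Set.indicator_of_mem hx f

variable (Ω) in
/-- Constant functions. -/
def const : V →ₗ[ℝ] SmoothFn Ω V where
  toFun c := ofContDiffOn (fun _ => c) contDiffOn_const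
  map_add' c d := ext_on fun x hx => by simp only [add_apply, ofContDiffOn_apply _ hx]
  map_smul' r c := ext_on fun x hx => by
    simp only [smul_apply, ofContDiffOn_apply _ hx, RingHom.id_apply]

theorem const_apply (c : V) {x : X} (hx : x ∈ Ω) : const Ω c x = c :=
  ofContDiffOn_apply contDiffOn_const hx

variable (Ω) in
/-- The restriction of a linear map to `Ω`. -/
def linear (w : X →L[ℝ] V) : SmoothFn Ω V := ofContDiffOn w w.contDiff.contDiffOn

theorem linear_apply (w : X →L[ℝ] V) {x : X} (hx : x ∈ Ω) : linear Ω w x = w x :=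
  ofContDiffOn_apply w.contDiff.contDiffOn hx

/-- Composition with a continuous linear map. -/
def postcomp (A : V →L[ℝ] W) : SmoothFn Ω V →ₗ[ℝ] SmoothFn Ω W where
  toFun f := ⟨fun x => A (f x), A.contDiff.comp_contDiffOn (contDiffOn f),
    fun x hx => (congrArg A (eq_zero_of_notMem f hx)).trans (map_zero A)⟩
  map_add' f g := by ext x; exact map_add A (f x) (g x)
  map_smul' c f := by ext x; exact map_smul A c (f x)

@[simp]
theorem postcomp_apply (A : V →L[ℝ] W) (f : SmoothFn Ω V) (x : X) : postcomp A f x = A (f x) := rfl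

/-- Multiplication by a smooth scalar function. -/
def smulBy (φ : X → ℝ) (hφ : ContDiffOn ℝ ∞ φ Ω) : Module.End ℝ (SmoothFn Ω V) where
  toFun f := ⟨fun x => φ x • f x, hφ.smul (contDiffOn f),
    fun x hx => (congrArg (φ x • ·) (eq_zero_of_notMem f hx)).trans (smul_zero _)⟩
  map_add' f g := by ext x; exact smul_add (φ x) (f x) (g x)
  map_smul' c f := by ext x; exact smul_comm (φ x) c (f x)

@[simp]
theorem smulBy_apply {φ : X → ℝ} (hφ : ContDiffOn ℝ ∞ φ Ω) (f : SmoothFn Ω V) (x : X) :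
    smulBy φ hφ f x = φ x • f x := rfl

theorem contDiffOn_fderiv_apply (f : SmoothFn Ω V) (v : X) :
    ContDiffOn ℝ ∞ (fun x => fderiv ℝ f x v) Ω :=
  ((contDiffOn f).fderiv_of_isOpen Ω.isOpen le_rfl).clm_apply contDiffOn_const

/-- The directional derivative along the vector `v`. -/
def dirDeriv (v : X) : Module.End ℝ (SmoothFn Ω V) where
  toFun f := ofContDiffOn _ (contDiffOn_fderiv_apply f v)
  map_add' f g := ext_on fun x hx => by
    simp only [add_apply, ofContDiffOn_apply _ hx]
    exact congrArg (· v) (fderiv_add (differentiableAt f hx) (differentiableAt g hx))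
  map_smul' c f := ext_on fun x hx => by
    simp only [smul_apply, ofContDiffOn_apply _ hx, RingHom.id_apply]
    exact congrArg (· v) (fderiv_const_smul (differentiableAt f hx) c)

theorem dirDeriv_apply (v : X) (f : SmoothFn Ω V) {x : X} (hx : x ∈ Ω) :
    dirDeriv v f x = fderiv ℝ f x v :=
  ofContDiffOn_apply (contDiffOn_fderiv_apply f v) hx

theorem dirDeriv_apply_of_eqOn {f : X → V} {g : SmoothFn Ω V} (h : ∀ x ∈ Ω, f x = g x) (v : X)
    {x : X} (hx : x ∈ Ω) : dirDeriv v g x = fderiv ℝ f x v := by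
  rw [dirDeriv_apply v g hx,
    (Filter.eventuallyEq_of_mem (Ω.isOpen.mem_nhds hx) h).fderiv_eq]

theorem dirDeriv_comm (v w : X) (f : SmoothFn Ω V) :
    dirDeriv v (dirDeriv w f) = dirDeriv w (dirDeriv v f) := by
  refine ext_on fun x hx => ?_
  have hfderiv : DifferentiableAt ℝ (fderiv ℝ f) x :=
    ((contDiffOn f).fderiv_of_isOpen Ω.isOpen (m := ∞) le_rfl).contDiffAt
      (Ω.isOpen.mem_nhds hx) |>.differentiableAt (by simp)
  have hsnd (v w : X) : dirDeriv v (dirDeriv w f) x = fderiv ℝ (fderiv ℝ f) x v w := by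
    rw [dirDeriv_apply_of_eqOn (fun z hz => (dirDeriv_apply w f hz).symm) v hx,
      fderiv_clm_apply hfderiv (differentiableAt_const w)]
    simp
  rw [hsnd, hsnd]
  exact (contDiffAt f hx).isSymmSndFDerivAt (by simpa using ENat.LEInfty.out) _ _

theorem dirDeriv_const (v : X) (c : V) : dirDeriv v (const Ω c) = 0 :=
  ext_on fun x hx => by
    rw [dirDeriv_apply_of_eqOn (fun z hz => (const_apply c hz).symm) v hx, fderiv_fun_const]
    rfl

theorem dirDeriv_linear (v : X) (w : X →L[ℝ] V) : dirDeriv v (linear Ω w) = const Ω (w v) :=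
  ext_on fun x hx => by
    rw [dirDeriv_apply_of_eqOn (fun z hz => (linear_apply w hz).symm) v hx, w.fderiv,
      const_apply _ hx]

theorem dirDeriv_postcomp (v : X) (A : V →L[ℝ] W) (f : SmoothFn Ω V) :
    dirDeriv v (postcomp A f) = postcomp A (dirDeriv v f) :=
  ext_on fun x hx => by
    rw [postcomp_apply, dirDeriv_apply v f hx, dirDeriv_apply v _ hx]
    exact congrArg (· v) (A.hasFDerivAt.comp x (differentiableAt f hx).hasFDerivAt).fderiv

theorem dirDeriv_smulBy {φ : X → ℝ} (hφ : ContDiffOn ℝ ∞ φ Ω) (f : SmoothFn Ω V) {x : X}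
    (hx : x ∈ Ω) {φ' : X →L[ℝ] ℝ} (hφ' : HasFDerivAt φ φ' x) (v : X) :
    dirDeriv v (smulBy φ hφ f) x = φ' v • f x + φ x • dirDeriv v f x := by
  rw [dirDeriv_apply v _ hx, dirDeriv_apply v _ hx, add_comm]
  exact congrArg (· v) (hφ'.smul (differentiableAt f hx).hasFDerivAt).fderiv

end SmoothFn

end SmoothFn

/-! ### The operators on smooth functions -/

section Basis

variable {m : ℕ}

theorem sum_smul_e (u : E m) : ∑ i, u i • e i = u := by
  simpa [e] using (EuclideanSpace.basisFun (Fin m) ℝ).sum_repr u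

theorem sum_smul_map_e {M : Type*} [AddCommGroup M] [Module ℝ M] (w : E m →ₗ[ℝ] M) (u : E m) :
    ∑ i, u i • w (e i) = w u := by
  conv_rhs => rw [← sum_smul_e u]
  simp

theorem inner_e (x : E m) (i : Fin m) : ⟪x, e i⟫_ℝ = x i := by
  simp [e, EuclideanSpace.inner_single_right]

theorem partialE_eq_fderiv {g : E m → Cl m} {x : E m} (hg : DifferentiableAt ℝ g x) (i : Fin m) :
    partialE i g x = fderiv ℝ g x (e i) :=
  hg.lineDeriv_eq_fderiv

theorem partialE_linear (w : E m →ₗ[ℝ] Cl m) (i : Fin m) (u : E m) : partialE i w u = w (e i) :=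
  (w.toContinuousLinearMap.hasFDerivAt.hasLineDerivAt (e i)).lineDeriv

end Basis

namespace SmoothFn

section MulLeft

variable {m : ℕ} {X : Type*} [NormedAddCommGroup X] [NormedSpace ℝ X] {Ω : Opens X}

/-- Left multiplication by a constant. -/
def mulLeft (a : Cl m) : Module.End ℝ (SmoothFn Ω (Cl m)) :=
  postcomp (LinearMap.mulLeft ℝ a).toContinuousLinearMap

@[simp]
theorem mulLeft_apply (a : Cl m) (f : SmoothFn Ω (Cl m)) (x : X) : mulLeft a f x = a * f x := rfl

theorem commute_mulLeft_dirDeriv (a : Cl m) (v : X) :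
    Commute (mulLeft a) (dirDeriv v : Module.End ℝ (SmoothFn Ω (Cl m))) :=
  LinearMap.ext fun f => (dirDeriv_postcomp v _ f).symm

end MulLeft

variable {m : ℕ}

/-- The partial derivatives and the multiplications by the `e_i` on the `Cl_m`-valued smooth
functions. -/
def diracSystem (Ω : Opens (E m)) : DiracSystem m (SmoothFn Ω (Cl m)) where
  deriv i := dirDeriv (e i)
  mulBasis i := mulLeft (vec (e i))
  commute_deriv i j := LinearMap.ext fun f => dirDeriv_comm (e i) (e j) f
  commute_mulBasis_deriv i j := commute_mulLeft_dirDeriv (vec (e i)) (e j)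

variable {Ω : Opens (E m)}

theorem mulVec_diracSystem (u : E m) : (diracSystem Ω).mulVec u = mulLeft (vec u) := by
  ext f x
  simp only [DiracSystem.mulVec, diracSystem, LinearMap.sum_apply, LinearMap.smul_apply, sum_apply,
    smul_apply, mulLeft_apply]
  simp only [← smul_mul_assoc, ← Finset.sum_mul, sum_smul_map_e]

theorem directional_diracSystem (u : E m) : (diracSystem Ω).directional u = dirDeriv u := by
  refine LinearMap.ext fun f => ext_on fun x hx => ?_
  simp only [DiracSystem.directional, diracSystem, LinearMap.sum_apply, LinearMap.smul_apply,
    sum_apply, smul_apply, dirDeriv_apply _ _ hx]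
  exact sum_smul_map_e (fderiv ℝ f x).toLinearMap u

/-- The function `F(x, u)` agrees on `Ω` with the family `b u` of smooth functions. -/
def Represents (F : E m → E m → Cl m) (b : E m → SmoothFn Ω (Cl m)) : Prop :=
  ∀ x ∈ Ω, ∀ u, F x u = b u x

namespace Represents

variable {F : E m → E m → Cl m} {b : E m → SmoothFn Ω (Cl m)}

theorem dX (h : Represents F b) (i : Fin m) :
    Represents (dX partialE i F) fun u => (diracSystem Ω).deriv i (b u) := fun x hx u => by
  have hF : (fun z => F z u) =ᶠ[nhds x] b u :=
    Filter.eventuallyEq_of_mem (Ω.isOpen.mem_nhds hx) fun z hz => h z hz u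
  exact hF.lineDeriv_eq.trans <| (partialE_eq_fderiv (differentiableAt (b u) hx) i).trans
    (dirDeriv_apply (e i) (b u) hx).symm

theorem laplaceX (h : Represents F b) :
    Represents (laplaceX partialE F) fun u => (diracSystem Ω).laplacian (b u) := fun x hx u => by
  simp only [Cylinder.laplaceX, DiracSystem.laplacian, LinearMap.sum_apply, sum_apply]
  exact Finset.sum_congr rfl fun i _ => (h.dX i).dX i x hx u

theorem laplaceX_iterate (h : Represents F b) (n : ℕ) :
    Represents ((Cylinder.laplaceX partialE)^[n] F)
      fun u => ((diracSystem Ω).laplacian ^ n) (b u) := by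
  induction n generalizing F b with
  | zero => exact h
  | succ _ ih => exact ih h.laplaceX

theorem diracX (h : Represents F b) :
    Represents (diracX partialE F) fun u => (diracSystem Ω).dirac (b u) := fun x hx u => by
  simp only [Cylinder.diracX, DiracSystem.dirac, LinearMap.sum_apply, sum_apply]
  exact Finset.sum_congr rfl fun i _ => congrArg _ (h.dX i x hx u)

theorem uDX (h : Represents F b) :
    Represents (uDX partialE F) fun u => (diracSystem Ω).directional u (b u) := fun x hx u => by
  simp only [Cylinder.uDX, DiracSystem.directional, LinearMap.sum_apply, sum_apply]
  exact Finset.sum_congr rfl fun i _ => congrArg _ (h.dX i x hx u)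

end Represents

/-- Evaluation at a point. -/
def eval (x : E m) : SmoothFn Ω (Cl m) →ₗ[ℝ] Cl m where
  toFun f := f x
  map_add' _ _ := rfl
  map_smul' _ _ := rfl

namespace Represents

variable {F : E m → E m → Cl m} {b : E m →ₗ[ℝ] SmoothFn Ω (Cl m)}

theorem dUdX (h : Represents F b) :
    Represents (dUdX partialE F) fun _ => (diracSystem Ω).divergence b := fun x hx u => by
  simp only [Cylinder.dUdX, DiracSystem.divergence, sum_apply]
  refine Finset.sum_congr rfl fun i _ => ?_
  rw [Cylinder.dU, funext fun w => h.dX i x hx w]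
  exact partialE_linear (eval x ∘ₗ (diracSystem Ω).deriv i ∘ₗ b) i u

theorem opE (h : Represents F b) (k : ℕ) :
    Represents (opE m k F) fun u => (diracSystem Ω).higherSpin k b u := by
  intro x hx u
  have hdiv (n : ℕ) := Represents.dUdX (b := ((diracSystem Ω).laplacian ^ n) ∘ₗ b)
    (h.laplaceX_iterate n)
  have hdivDirac (n : ℕ) := Represents.dUdX
    (b := ((diracSystem Ω).laplacian ^ n) ∘ₗ (diracSystem Ω).dirac ∘ₗ b)
    (h.diracX.laplaceX_iterate n)
  unfold Cylinder.opE higherSpin DiracSystem.higherSpin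
  split_ifs
  · rw [bosonic, h.laplaceX_iterate _ x hx u, (hdiv _).uDX x hx u]
    rfl
  · rw [fermionic, (h.laplaceX_iterate _).diracX x hx u, hdiv _ x hx u,
      (hdivDirac _).uDX x hx u, ← mulLeft_apply, ← mulVec_diracSystem]
    rfl

theorem contDiffOn (h : Represents F b) :
    ContDiffOn ℝ ∞ (fun p : E m × E m => F p.1 p.2) ((Ω : Set (E m)) ×ˢ Set.univ) := by
  have hsmooth : ContDiffOn ℝ ∞ (fun p : E m × E m => ∑ i, p.2 i • b (e i) p.1)
      ((Ω : Set (E m)) ×ˢ Set.univ) :=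
    ContDiffOn.sum fun i _ => ContDiffOn.fun_smul (ContDiff.contDiffOn (by fun_prop))
      ((SmoothFn.contDiffOn (b (e i))).comp contDiffOn_fst fun p hp => hp.1)
  exact hsmooth.congr fun p hp =>
    (h p.1 hp.1 p.2).trans (sum_smul_map_e (eval p.1 ∘ₗ b) p.2).symm

end Represents

end SmoothFn

/-! ### Multiplication by coordinates and by powers of the norm -/

section Norm

variable {X : Type*} [NormedAddCommGroup X] [InnerProductSpace ℝ X]

variable (X) in
/-- The complement of the origin. -/
def punctured : Opens X := ⟨{0}ᶜ, isOpen_compl_singleton⟩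

theorem contDiffOn_norm_zpow (p : ℤ) : ContDiffOn ℝ ∞ (fun x : X => ‖x‖ ^ p) (punctured X) := by
  intro x hx
  have hx : x ≠ 0 := hx
  have hnorm : ContDiffAt ℝ ∞ (fun x : X => ‖x‖) x := contDiffAt_norm ℝ hx
  refine ContDiffAt.contDiffWithinAt ?_
  obtain ⟨n, rfl | rfl⟩ := p.eq_nat_or_neg
  · simpa using hnorm.pow n
  · simp only [zpow_neg, zpow_natCast]
    exact (hnorm.pow n).inv (pow_ne_zero n (norm_ne_zero_iff.2 hx))

theorem hasFDerivAt_norm_zpow (p : ℤ) {x : X} (hx : x ≠ 0) :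
    HasFDerivAt (fun x : X => ‖x‖ ^ p) (((p : ℝ) * ‖x‖ ^ (p - 2)) • innerSL ℝ x) x := by
  have hnorm : ‖x‖ ≠ 0 := norm_ne_zero_iff.2 hx
  have hsqrt := (hasStrictFDerivAt_norm_sq x).hasFDerivAt.sqrt (pow_ne_zero 2 hnorm)
  simp only [Real.sqrt_sq (norm_nonneg _)] at hsqrt
  refine ((hasDerivAt_zpow p ‖x‖ (Or.inl hnorm)).comp_hasFDerivAt x hsqrt).congr_fderiv ?_
  have hpow : ‖x‖ ^ (p - 1) = ‖x‖ ^ (p - 2) * ‖x‖ := by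
    rw [← zpow_add_one₀ hnorm]
    congr 1
    ring
  ext v
  simp only [hpow, one_div, mul_inv_rev, smul_apply, coe_innerSL_apply, nsmul_eq_mul,
    Nat.cast_ofNat, smul_eq_mul]
  field_simp

end Norm

namespace SmoothFn

section Multiplication

variable {X V W : Type*} [NormedAddCommGroup X] [InnerProductSpace ℝ X] [NormedAddCommGroup V]
  [NormedSpace ℝ V] [NormedAddCommGroup W] [NormedSpace ℝ W] {Ω : Opens X}

theorem contDiffOn_inner_const (u : X) : ContDiffOn ℝ ∞ (fun x => ⟪x, u⟫_ℝ) Ω :=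
  (contDiff_id.inner ℝ contDiff_const).contDiffOn

/-- Multiplication by `⟪x, u⟫`. -/
def innerMul : X →ₗ[ℝ] Module.End ℝ (SmoothFn Ω V) where
  toFun u := smulBy (fun x => ⟪x, u⟫_ℝ) (contDiffOn_inner_const u)
  map_add' u v := by
    ext f x
    simp only [smulBy_apply, LinearMap.add_apply, add_apply, inner_add_right, add_smul]
  map_smul' c u := by
    ext f x
    simp only [smulBy_apply, LinearMap.smul_apply, smul_apply, inner_smul_right, mul_smul,
      RingHom.id_apply]

@[simp]
theorem innerMul_apply (u : X) (f : SmoothFn Ω V) (x : X) : innerMul u f x = ⟪x, u⟫_ℝ • f x := rfl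

theorem innerMul_comm (u v : X) (f : SmoothFn Ω V) :
    innerMul u (innerMul v f) = innerMul v (innerMul u f) :=
  ext_on fun x _ => smul_comm ⟪x, u⟫_ℝ ⟪x, v⟫_ℝ (f x)

theorem dirDeriv_innerMul (v u : X) (f : SmoothFn Ω V) :
    dirDeriv v (innerMul u f) = ⟪v, u⟫_ℝ • f + innerMul u (dirDeriv v f) := by
  refine ext_on fun x hx => ?_
  have hinner : HasFDerivAt (fun x : X => ⟪x, u⟫_ℝ) (innerSL ℝ u) x := by
    simpa [real_inner_comm] using (innerSL ℝ u).hasFDerivAt (x := x)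
  exact (dirDeriv_smulBy (contDiffOn_inner_const u) f hx hinner v).trans (by simp [real_inner_comm])

/-- Multiplication by `‖x‖ ^ p`. -/
def normPow (p : ℤ) : Module.End ℝ (SmoothFn (punctured X) V) :=
  smulBy (fun x => ‖x‖ ^ p) (contDiffOn_norm_zpow p)

@[simp]
theorem normPow_apply (p : ℤ) (f : SmoothFn (punctured X) V) (x : X) :
    normPow p f x = ‖x‖ ^ p • f x := rfl

theorem normPow_normPow (p q : ℤ) (f : SmoothFn (punctured X) V) :
    normPow p (normPow q f) = normPow (p + q) f :=
  ext_on fun x hx => by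
    simp only [normPow_apply, smul_smul, zpow_add₀ (norm_ne_zero_iff.2 hx)]

theorem innerMul_normPow (u : X) (p : ℤ) (f : SmoothFn (punctured X) V) :
    innerMul u (normPow p f) = normPow p (innerMul u f) :=
  ext_on fun x _ => smul_comm ⟪x, u⟫_ℝ (‖x‖ ^ p) (f x)

theorem dirDeriv_normPow (v : X) (p : ℤ) (f : SmoothFn (punctured X) V) :
    dirDeriv v (normPow p f) = (p : ℝ) • normPow (p - 2) (innerMul v f)
      + normPow p (dirDeriv v f) :=
  ext_on fun x hx => by
    rw [normPow, dirDeriv_smulBy _ f hx (hasFDerivAt_norm_zpow p hx)]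
    simp [mul_smul, normPow]

end Multiplication

/-! ### Calculus of Clifford-valued functions -/

section Clifford

variable {m : ℕ}

theorem inner_e_self (i : Fin m) : ⟪e i, e i⟫_ℝ = (1 : ℝ) := by
  simp [e]

theorem sum_sq_eq_norm_sq (x : E m) : ∑ i, x i * x i = ‖x‖ ^ 2 := by
  simp_rw [EuclideanSpace.norm_sq_eq, Real.norm_eq_abs, sq_abs, sq]

theorem vec_mul_vec_add_swap (x y : E m) :
    vec x * vec y = -(vec y * vec x) - (2 * ⟪x, y⟫_ℝ) • (1 : Cl m) := by
  have hpolar : QuadraticMap.polar (negSq m) x y = -(2 * ⟪x, y⟫_ℝ) := by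
    simp only [QuadraticMap.polar, negSq_apply, norm_add_sq_real]
    ring
  have hswap := CliffordAlgebra.ι_mul_ι_add_swap (Q := negSq m) x y
  rw [hpolar, Algebra.algebraMap_eq_smul_one] at hswap
  rw [eq_sub_of_add_eq hswap]
  module

variable {Ω : Opens (E m)}

theorem laplacian_apply (f : SmoothFn Ω (Cl m)) :
    (diracSystem Ω).laplacian f = ∑ i, dirDeriv (e i) (dirDeriv (e i) f) := by
  simp only [DiracSystem.laplacian, LinearMap.sum_apply, Module.End.mul_apply, diracSystem]

theorem dirac_apply (f : SmoothFn Ω (Cl m)) :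
    (diracSystem Ω).dirac f = ∑ i, mulLeft (vec (e i)) (dirDeriv (e i) f) := by
  simp only [DiracSystem.dirac, LinearMap.sum_apply, Module.End.mul_apply, diracSystem]

theorem divergence_apply (b : E m →ₗ[ℝ] SmoothFn Ω (Cl m)) :
    (diracSystem Ω).divergence b = ∑ i, dirDeriv (e i) (b (e i)) := rfl

theorem sum_smul_dirDeriv (u : E m) (f : SmoothFn Ω (Cl m)) :
    ∑ i, u i • dirDeriv (e i) f = dirDeriv u f := by
  rw [← directional_diracSystem, DiracSystem.directional, LinearMap.sum_apply]
  rfl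

theorem sum_smul_mulLeft (u : E m) (f : SmoothFn Ω (Cl m)) :
    ∑ i, u i • mulLeft (vec (e i)) f = mulLeft (vec u) f := by
  rw [← mulVec_diracSystem, DiracSystem.mulVec, LinearMap.sum_apply]
  rfl

/-- Left multiplication by the vector variable `x`. -/
def mulVar : Module.End ℝ (SmoothFn Ω (Cl m)) := ∑ i, mulLeft (vec (e i)) * innerMul (e i)

theorem sum_mulLeft_innerMul (f : SmoothFn Ω (Cl m)) :
    ∑ i, mulLeft (vec (e i)) (innerMul (e i) f) = mulVar f := by
  simp only [mulVar, LinearMap.sum_apply, Module.End.mul_apply]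

@[simp]
theorem mulVar_apply (f : SmoothFn Ω (Cl m)) (x : E m) : mulVar f x = vec x * f x := by
  have hvec : vec x = ∑ i, x i • vec (e i) :=
    (sum_smul_map_e (CliffordAlgebra.ι (negSq m)) x).symm
  rw [hvec, Finset.sum_mul, ← sum_mulLeft_innerMul, sum_apply]
  exact Finset.sum_congr rfl fun i _ => by
    rw [mulLeft_apply, innerMul_apply, inner_e, mul_smul_comm, smul_mul_assoc]

/-- The Euler operator `∑ x_i ∂_{x_i}`. -/
def euler : Module.End ℝ (SmoothFn Ω (Cl m)) := ∑ i, innerMul (e i) * dirDeriv (e i)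

theorem euler_apply (f : SmoothFn Ω (Cl m)) : euler f = ∑ i, innerMul (e i) (dirDeriv (e i) f) := by
  simp only [euler, LinearMap.sum_apply, Module.End.mul_apply]

theorem mulLeft_const (a c : Cl m) : mulLeft a (const Ω c) = const Ω (a * c) :=
  ext_on fun x hx => by simp only [mulLeft_apply, const_apply _ hx]

theorem mulLeft_innerMul (a : Cl m) (u : E m) (f : SmoothFn Ω (Cl m)) :
    mulLeft a (innerMul u f) = innerMul u (mulLeft a f) :=
  ext_on fun x _ => mul_smul_comm ⟪x, u⟫_ℝ a (f x)

theorem mulLeft_e_mulLeft_e (i : Fin m) (f : SmoothFn Ω (Cl m)) :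
    mulLeft (vec (e i)) (mulLeft (vec (e i)) f) = -f := by
  ext x
  rw [mulLeft_apply, mulLeft_apply, ← mul_assoc, vec_mul_self]
  simp [e]

theorem mulLeft_mulVar (u : E m) (f : SmoothFn Ω (Cl m)) :
    mulLeft (vec u) (mulVar f) = -mulVar (mulLeft (vec u) f) - (2 : ℝ) • innerMul u f := by
  ext x
  simp only [mulLeft_apply, mulVar_apply, sub_apply, neg_apply, smul_apply, innerMul_apply,
    ← mul_assoc]
  rw [vec_mul_vec_add_swap, sub_mul, real_inner_comm, smul_mul_assoc, one_mul, smul_smul, neg_mul]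

theorem dirDeriv_mulVar (v : E m) (f : SmoothFn Ω (Cl m)) :
    dirDeriv v (mulVar f) = mulLeft (vec v) f + mulVar (dirDeriv v f) := by
  simp only [← sum_mulLeft_innerMul, map_sum, ← sum_smul_mulLeft v f, ← Finset.sum_add_distrib]
  refine Finset.sum_congr rfl fun i _ => ?_
  rw [← Module.End.mul_apply (dirDeriv v), ← commute_mulLeft_dirDeriv, Module.End.mul_apply,
    dirDeriv_innerMul, inner_e, map_add, map_smul]

theorem sum_innerMul_const (w : E m →L[ℝ] Cl m) :
    ∑ i, innerMul (e i) (const Ω (w (e i))) = linear Ω w :=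
  ext_on fun x hx => by
    simp only [sum_apply, innerMul_apply, inner_e, const_apply _ hx, linear_apply _ hx]
    exact sum_smul_map_e w.toLinearMap x

theorem euler_const (c : Cl m) : euler (const Ω c) = 0 := by
  simp only [euler_apply, dirDeriv_const, map_zero, Finset.sum_const_zero]

theorem euler_linear (w : E m →L[ℝ] Cl m) : euler (linear Ω w) = linear Ω w := by
  simp only [euler_apply, dirDeriv_linear, sum_innerMul_const]

theorem sum_smul_innerMul (u : E m) (f : SmoothFn Ω (Cl m)) :
    ∑ i, u i • innerMul (e i) f = innerMul u f := by
  ext x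
  simp only [sum_apply, smul_apply, innerMul_apply, smul_smul, ← Finset.sum_smul]
  congr 1
  simpa using sum_smul_map_e (innerₗ (E m) x) u

theorem euler_innerMul (u : E m) (f : SmoothFn Ω (Cl m)) :
    euler (innerMul u f) = innerMul u f + innerMul u (euler f) := by
  simp only [euler_apply, dirDeriv_innerMul, real_inner_comm, inner_e, map_add, map_smul,
    Finset.sum_add_distrib, sum_smul_innerMul, map_sum, innerMul_comm u]

theorem laplacian_const (c : Cl m) : (diracSystem Ω).laplacian (const Ω c) = 0 := by
  simp only [laplacian_apply, dirDeriv_const, map_zero, Finset.sum_const_zero]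

theorem laplacian_linear (w : E m →L[ℝ] Cl m) : (diracSystem Ω).laplacian (linear Ω w) = 0 := by
  simp only [laplacian_apply, dirDeriv_linear, dirDeriv_const, Finset.sum_const_zero]

theorem laplacian_innerMul (u : E m) (f : SmoothFn Ω (Cl m)) :
    (diracSystem Ω).laplacian (innerMul u f) =
      (2 : ℝ) • dirDeriv u f + innerMul u ((diracSystem Ω).laplacian f) := by
  simp only [laplacian_apply, dirDeriv_innerMul, real_inner_comm, inner_e, map_add, map_smul,
    Finset.sum_add_distrib, map_sum, sum_smul_dirDeriv]
  module

theorem dirac_const (c : Cl m) : (diracSystem Ω).dirac (const Ω c) = 0 := by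
  simp only [dirac_apply, dirDeriv_const, map_zero, Finset.sum_const_zero]

theorem dirac_linear (w : E m →L[ℝ] Cl m) :
    (diracSystem Ω).dirac (linear Ω w) = const Ω (∑ i, vec (e i) * w (e i)) := by
  simp only [dirac_apply, dirDeriv_linear, mulLeft_const, map_sum]

theorem dirac_innerMul (u : E m) (f : SmoothFn Ω (Cl m)) :
    (diracSystem Ω).dirac (innerMul u f) =
      mulLeft (vec u) f + innerMul u ((diracSystem Ω).dirac f) := by
  simp only [dirac_apply, dirDeriv_innerMul, real_inner_comm, inner_e, map_add, map_smul,
    Finset.sum_add_distrib, map_sum, mulLeft_innerMul, sum_smul_mulLeft]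

end Clifford

section Punctured

variable {m : ℕ}

theorem sum_innerMul_innerMul (f : SmoothFn (punctured (E m)) (Cl m)) :
    ∑ i, innerMul (e i) (innerMul (e i) f) = normPow 2 f := by
  ext x
  simp only [sum_apply, innerMul_apply, smul_smul, ← Finset.sum_smul, inner_e, normPow_apply,
    sum_sq_eq_norm_sq]
  rfl

theorem mulVar_mulVar (f : SmoothFn (punctured (E m)) (Cl m)) :
    mulVar (mulVar f) = -normPow 2 f := by
  ext x
  rw [mulVar_apply, mulVar_apply, ← mul_assoc, vec_mul_self, Algebra.algebraMap_eq_smul_one,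
    smul_mul_assoc, one_mul, neg_smul]
  rfl

theorem mulLeft_normPow (a : Cl m) (p : ℤ) (f : SmoothFn (punctured (E m)) (Cl m)) :
    mulLeft a (normPow p f) = normPow p (mulLeft a f) :=
  ext_on fun x _ => mul_smul_comm (‖x‖ ^ p) a (f x)

theorem mulVar_normPow (p : ℤ) (f : SmoothFn (punctured (E m)) (Cl m)) :
    mulVar (normPow p f) = normPow p (mulVar f) := by
  ext x
  simp only [mulVar_apply, normPow_apply, mul_smul_comm]

theorem laplacian_normPow (p : ℤ) (f : SmoothFn (punctured (E m)) (Cl m)) :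
    (diracSystem _).laplacian (normPow p f) = (p * (p + m - 2) : ℝ) • normPow (p - 2) f
      + (2 * p : ℝ) • normPow (p - 2) (euler f) + normPow p ((diracSystem _).laplacian f) := by
  have hterm (i : Fin m) : dirDeriv (e i) (dirDeriv (e i) (normPow p f)) =
      (p * (p - 2) : ℝ) • normPow (p - 4) (innerMul (e i) (innerMul (e i) f))
        + (p : ℝ) • normPow (p - 2) f + (2 * p : ℝ) • normPow (p - 2) (innerMul (e i)
          (dirDeriv (e i) f)) + normPow p (dirDeriv (e i) (dirDeriv (e i) f)) := by
    simp only [dirDeriv_normPow, map_add, map_smul, dirDeriv_innerMul, inner_e_self,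
      show p - 2 - 2 = p - 4 by ring]
    push_cast
    module
  simp only [laplacian_apply, hterm, Finset.sum_add_distrib, ← Finset.smul_sum, ← map_sum,
    sum_innerMul_innerMul, normPow_normPow, show p - 4 + 2 = p - 2 by ring, ← euler_apply,
    Finset.sum_const, Finset.card_univ, Fintype.card_fin, ← Nat.cast_smul_eq_nsmul ℝ,
    map_smul]
  module

theorem dirac_normPow_mulVar (p : ℤ) (f : SmoothFn (punctured (E m)) (Cl m)) :
    (diracSystem _).dirac (normPow p (mulVar f)) = (-(p + m) : ℝ) • normPow p f
      - normPow p (mulVar ((diracSystem _).dirac f)) - (2 : ℝ) • normPow p (euler f) := by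
  have hterm (i : Fin m) : mulLeft (vec (e i)) (dirDeriv (e i) (normPow p (mulVar f))) =
      (p : ℝ) • normPow (p - 2) (mulLeft (vec (e i)) (innerMul (e i) (mulVar f)))
        - normPow p f - normPow p (mulVar (mulLeft (vec (e i)) (dirDeriv (e i) f)))
        - (2 : ℝ) • normPow p (innerMul (e i) (dirDeriv (e i) f)) := by
    simp only [dirDeriv_normPow, dirDeriv_mulVar, map_add, map_smul, mulLeft_normPow,
      mulLeft_e_mulLeft_e, mulLeft_mulVar, map_neg, map_sub]
    module
  simp only [dirac_apply, hterm, Finset.sum_sub_distrib, ← Finset.smul_sum, ← map_sum,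
    sum_mulLeft_innerMul, mulVar_mulVar, map_neg, normPow_normPow, sub_add_cancel, ← euler_apply,
    Finset.sum_const, Finset.card_univ, Fintype.card_fin, ← Nat.cast_smul_eq_nsmul ℝ,
    map_smul]
  module

end Punctured

end SmoothFn

/-! ### The operators annihilate the kernels on the punctured space -/

section Kernels

open SmoothFn

variable {m : ℕ}

/-- The function `‖x‖^a w(xux/‖x‖²)` of `x`, linear in `u`. -/
def scalarKernel (a : ℤ) (w : E m →L[ℝ] Cl m) : E m →ₗ[ℝ] SmoothFn (punctured (E m)) (Cl m) :=
  normPow a ∘ₗ const _ ∘ₗ w.toLinearMap - (2 : ℝ) • normPow (a - 2) ∘ₗ innerMul.flip (linear _ w)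

theorem scalarKernel_eq (a : ℤ) (w : E m →L[ℝ] Cl m) (u : E m) :
    scalarKernel a w u =
      normPow a (const _ (w u)) - (2 : ℝ) • normPow (a - 2) (innerMul u (linear _ w)) := rfl

theorem scalarKernel_apply (a : ℤ) (w : E m →L[ℝ] Cl m) (u : E m) {x : E m} (hx : x ≠ 0) :
    scalarKernel a w u x = ‖x‖ ^ a • w (sandwich x u) := by
  have hmem : x ∈ punctured (E m) := hx
  simp only [scalarKernel_eq, SmoothFn.sub_apply, SmoothFn.smul_apply, normPow_apply,
    innerMul_apply, const_apply _ hmem, linear_apply _ hmem, sandwich, map_sub, map_smul,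
    zpow_sub₀ (norm_ne_zero_iff.2 hx) a 2]
  rw [smul_sub]
  norm_cast
  module

theorem sum_innerMul_scalarKernel (a : ℤ) (w : E m →L[ℝ] Cl m) :
    ∑ i, innerMul (e i) (scalarKernel a w (e i)) = -normPow a (linear _ w) := by
  simp only [scalarKernel_eq, map_sub, map_smul, innerMul_normPow, Finset.sum_sub_distrib,
    ← Finset.smul_sum, ← map_sum, sum_innerMul_const, sum_innerMul_innerMul, normPow_normPow,
    sub_add_cancel]
  module

theorem divergence_scalarKernel (a : ℤ) (w : E m →L[ℝ] Cl m) :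
    (diracSystem _).divergence (scalarKernel a w) =
      (2 - 2 * m - a : ℝ) • normPow (a - 2) (linear _ w) := by
  have hterm (i : Fin m) : dirDeriv (e i) (scalarKernel a w (e i)) =
      (a - 2 : ℝ) • normPow (a - 2) (innerMul (e i) (const _ (w (e i))))
        - (2 * (a - 2) : ℝ) • normPow (a - 4) (innerMul (e i) (innerMul (e i) (linear _ w)))
        - (2 : ℝ) • normPow (a - 2) (linear _ w) := by
    simp only [scalarKernel_eq, map_sub, map_smul, dirDeriv_normPow, dirDeriv_const,
      dirDeriv_innerMul, dirDeriv_linear, map_add, map_zero, inner_e_self,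
      show a - 2 - 2 = a - 4 by ring]
    push_cast
    module
  simp only [divergence_apply, hterm, Finset.sum_sub_distrib, ← Finset.smul_sum, ← map_sum,
    sum_innerMul_const, sum_innerMul_innerMul, normPow_normPow, show a - 4 + 2 = a - 2 by ring,
    Finset.sum_const, Finset.card_univ, Fintype.card_fin, ← Nat.cast_smul_eq_nsmul ℝ, map_smul]
  module

theorem laplacian_scalarKernel_add (n : ℕ) {a : ℤ} (ha : a = 2 * n - m) (w : E m →L[ℝ] Cl m)
    (u : E m) :
    (diracSystem _).laplacian (scalarKernel a w u)
        + (4 * n : ℝ) • dirDeriv u (normPow (a - 2) (linear _ w)) =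
      ((2 * n - 2) * (2 * n - m + 2) : ℝ) • normPow (a - 2) (const _ (w u)) := by
  have ha' : (a : ℝ) = 2 * n - m := by rw [ha]; push_cast; ring
  simp only [scalarKernel_eq, map_sub, map_smul, laplacian_normPow, laplacian_const,
    laplacian_innerMul, laplacian_linear, euler_const, euler_innerMul, euler_linear,
    dirDeriv_linear, dirDeriv_normPow, map_add, map_zero, show a - 2 - 2 = a - 4 by ring]
  push_cast
  rw [ha']
  module

theorem laplacian_pow_normPow_const (n : ℕ) (c : Cl m) :
    ((diracSystem _).laplacian ^ (n + 1)) (normPow (2 * (n + 1 : ℕ) - m) (const _ c)) = 0 := by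
  induction n with
  | zero =>
    rw [zero_add, pow_one, laplacian_normPow, euler_const, laplacian_const]
    simp
  | succ n ih =>
    have hexp : (2 * ((n + 1 + 1 : ℕ) : ℤ) - m - 2) = 2 * (n + 1 : ℕ) - m := by push_cast; ring
    rw [pow_succ, Module.End.mul_apply, laplacian_normPow, euler_const, laplacian_const, hexp]
    simp only [map_zero, smul_zero, add_zero, map_smul, ih]

theorem laplacian_pow_laplacian_scalarKernel_add (n : ℕ) {a : ℤ} (ha : a = 2 * (n + 1 : ℕ) - m)
    (w : E m →L[ℝ] Cl m) (u : E m) :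
    ((diracSystem _).laplacian ^ n) ((diracSystem _).laplacian (scalarKernel a w u)
      + (4 * (n + 1 : ℕ) : ℝ) • dirDeriv u (normPow (a - 2) (linear _ w))) = 0 := by
  rw [laplacian_scalarKernel_add (n + 1) ha, map_smul]
  cases n with
  | zero => simp
  | succ n =>
    have hexp : a - 2 = 2 * (n + 1 : ℕ) - m := by rw [ha]; push_cast; ring
    rw [hexp, laplacian_pow_normPow_const, smul_zero]

theorem bosonic_scalarKernel [NeZero m] (n : ℕ) {a : ℤ} (ha : a = 2 * (n + 1 : ℕ) - m)
    (w : E m →L[ℝ] Cl m) (u : E m) :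
    (diracSystem _).bosonic (n + 1) (scalarKernel a w) u = 0 := by
  have hm : (m : ℝ) ≠ 0 := NeZero.ne _
  have hcoeff : -(4 * (n + 1) / (m + 2 * n) * (2 - 2 * m - a)) = (4 * (n + 1 : ℕ) : ℝ) := by
    rw [ha]
    push_cast
    field_simp
    ring
  rw [DiracSystem.bosonic_succ, directional_diracSystem, divergence_scalarKernel, map_smul,
    smul_smul, sub_eq_add_neg, ← neg_smul, hcoeff, laplacian_pow_laplacian_scalarKernel_add n ha]

/-- The function `x ‖x‖^a w(xux/‖x‖²)` of `x`, linear in `u`. -/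
def spinorKernel (a : ℤ) (w : E m →L[ℝ] Cl m) : E m →ₗ[ℝ] SmoothFn (punctured (E m)) (Cl m) :=
  mulVar ∘ₗ scalarKernel a w

theorem spinorKernel_apply (a : ℤ) (w : E m →L[ℝ] Cl m) (u : E m) {x : E m} (hx : x ≠ 0) :
    spinorKernel a w u x = ‖x‖ ^ a • (vec x * w (sandwich x u)) := by
  rw [spinorKernel, LinearMap.comp_apply, mulVar_apply, scalarKernel_apply a w u hx, mul_smul_comm]

section Monogenic

variable {w : E m →L[ℝ] Cl m} (hw : ∑ i, vec (e i) * w (e i) = 0)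
include hw

theorem sum_mulLeft_scalarKernel (a : ℤ) : ∑ i, mulLeft (vec (e i)) (scalarKernel a w (e i)) =
    (-2 : ℝ) • normPow (a - 2) (mulVar (linear _ w)) := by
  simp only [scalarKernel_eq, map_sub, map_smul, mulLeft_normPow, mulLeft_const,
    Finset.sum_sub_distrib, ← Finset.smul_sum, ← map_sum, hw, sum_mulLeft_innerMul, map_zero]
  module

theorem sum_mulLeft_spinorKernel (a : ℤ) :
    ∑ i, mulLeft (vec (e i)) (spinorKernel a w (e i)) = 0 := by
  simp only [spinorKernel, LinearMap.comp_apply, mulLeft_mulVar, Finset.sum_sub_distrib,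
    Finset.sum_neg_distrib, ← Finset.smul_sum, ← map_sum, sum_mulLeft_scalarKernel hw,
    sum_innerMul_scalarKernel, map_smul, mulVar_normPow, mulVar_mulVar, map_neg, normPow_normPow,
    sub_add_cancel]
  module

theorem divergence_spinorKernel (a : ℤ) :
    (diracSystem _).divergence (spinorKernel a w) =
      (-(2 * m + a) : ℝ) • normPow (a - 2) (mulVar (linear _ w)) := by
  have hsum : (diracSystem _).divergence (spinorKernel a w) =
      ∑ i, mulLeft (vec (e i)) (scalarKernel a w (e i))
        + mulVar ((diracSystem _).divergence (scalarKernel a w)) := by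
    simp only [divergence_apply, spinorKernel, LinearMap.comp_apply, dirDeriv_mulVar,
      Finset.sum_add_distrib, map_sum]
  rw [hsum, sum_mulLeft_scalarKernel hw, divergence_scalarKernel, map_smul, mulVar_normPow]
  module

theorem dirac_spinorKernel (a : ℤ) (u : E m) :
    (diracSystem _).dirac (spinorKernel a w u) = (-(a + m) : ℝ) • scalarKernel a w u
      - (2 : ℝ) • normPow (a - 2) (mulLeft (vec u) (mulVar (linear _ w))) := by
  have hspinor : spinorKernel a w u = normPow a (mulVar (const _ (w u)))
      - (2 : ℝ) • normPow (a - 2) (mulVar (innerMul u (linear _ w))) := by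
    simp only [spinorKernel, LinearMap.comp_apply, scalarKernel_eq, map_sub, map_smul,
      mulVar_normPow]
  simp only [hspinor, scalarKernel_eq, map_sub, map_smul, dirac_normPow_mulVar, dirac_const,
    dirac_innerMul, dirac_linear, hw, euler_const, euler_innerMul, euler_linear, map_zero,
    map_add, mulLeft_mulVar, map_neg]
  push_cast
  module

theorem dirac_divergence_spinorKernel (a : ℤ) :
    (diracSystem _).dirac ((diracSystem _).divergence (spinorKernel a w)) =
      ((2 * m + a) * (a + m) : ℝ) • normPow (a - 2) (linear _ w) := by
  rw [divergence_spinorKernel hw, map_smul, dirac_normPow_mulVar, dirac_linear, hw, euler_linear,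
    map_zero, map_zero, map_zero]
  push_cast
  module

/-- In the combination of the first two terms of `𝒟_{1,2n-1}` the terms containing `u x w(x)`
cancel. -/
theorem dirac_sub_mulVec_spinorKernel [NeZero m] (n : ℕ) {a : ℤ} (ha : a = 2 * n - m) (u : E m) :
    (diracSystem _).dirac (spinorKernel a w u) - (2 / (m + 2 * n) : ℝ) •
      (diracSystem _).mulVec u ((diracSystem _).divergence (spinorKernel a w)) =
        (-(2 * n) : ℝ) • scalarKernel a w u := by
  have hm : (m : ℝ) ≠ 0 := NeZero.ne _
  have ha' : (a : ℝ) = 2 * n - m := by rw [ha]; push_cast; ring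
  have hcoeff : (2 + 2 / (m + 2 * n) * -(2 * m + a) : ℝ) = 0 := by
    rw [ha']
    field_simp
    ring
  rw [dirac_spinorKernel hw, divergence_spinorKernel hw, mulVec_diracSystem, map_smul,
    mulLeft_normPow, smul_smul, sub_sub, ← add_smul, hcoeff, zero_smul, sub_zero, ha',
    sub_add_cancel]

theorem fermionic_spinorKernel [NeZero m] (n : ℕ) {a : ℤ} (ha : a = 2 * n - m) (u : E m) :
    (diracSystem _).fermionic (n + 1) (spinorKernel a w) u = 0 := by
  have hcancel := dirac_sub_mulVec_spinorKernel hw n ha u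
  cases n with
  | zero =>
    rw [zero_add, DiracSystem.fermionic_one]
    simpa using hcancel
  | succ n =>
    have hcoeff : (4 * (n + 1) / (m + 2 * (n + 1)) * ((2 * m + a) * (a + m)) : ℝ) =
        2 * (n + 1) * (4 * (n + 1 : ℕ)) := by
      rw [ha]
      push_cast
      field_simp
      ring
    have hlap := laplacian_pow_laplacian_scalarKernel_add n ha w u
    have hfactor (f g : SmoothFn (punctured (E m)) (Cl m)) :
        (-(2 * (n + 1)) : ℝ) • f - (2 * (n + 1) * (4 * (n + 1 : ℕ)) : ℝ) • g =
          (-(2 * (n + 1)) : ℝ) • (f + (4 * (n + 1 : ℕ) : ℝ) • g) := by module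
    push_cast at hcancel
    rw [DiracSystem.fermionic_add_two, hcancel, directional_diracSystem,
      dirac_divergence_spinorKernel hw, map_smul, map_smul, smul_smul, hcoeff, hfactor, map_smul,
      hlap, smul_zero]

end Monogenic

end Kernels

/-! ### Homogeneous and decaying functions -/

theorem isBigO_norm_zpow_of_le {X : Type*} [NormedAddCommGroup X] {p q : ℤ} (hpq : p ≤ q) :
    (fun x : X => ‖x‖ ^ p) =O[cobounded X] fun x => ‖x‖ ^ q := by
  refine IsBigO.of_norm_eventuallyLE ?_
  filter_upwards [tendsto_norm_cobounded_atTop.eventually_ge_atTop 1] with x hx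
  rw [norm_zpow, norm_norm]
  exact zpow_le_zpow_right₀ hx hpq

section Homogeneous

variable {X V W : Type*} [NormedAddCommGroup X] [NormedSpace ℝ X] [NormedAddCommGroup V]
  [NormedSpace ℝ V] [NormedAddCommGroup W] [NormedSpace ℝ W]

/-- Positive homogeneity of degree `d`. -/
def IsPosHomogeneous (d : ℤ) (f : X → V) : Prop :=
  ∀ t : ℝ, 0 < t → ∀ x, f (t • x) = t ^ d • f x

namespace IsPosHomogeneous

variable {d : ℤ} {f : X → V}

theorem fderiv (hf : IsPosHomogeneous d f) : IsPosHomogeneous (d - 1) (fderiv ℝ f) := by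
  intro t ht x
  have hscale : t • _root_.fderiv ℝ f (t • x) = t ^ d • _root_.fderiv ℝ f x := by
    rw [← fderiv_comp_smul, funext (hf t ht)]
    exact congrFun (fderiv_const_smul_field (t ^ d)) x
  rw [zpow_sub_one₀ ht.ne', mul_comm, mul_smul, ← hscale, inv_smul_smul₀ ht.ne']

theorem iteratedFDeriv (hf : IsPosHomogeneous d f) (n : ℕ) :
    IsPosHomogeneous (d - n) (iteratedFDeriv ℝ n f) := by
  induction n with
  | zero =>
    intro t ht x
    ext v
    simp [hf t ht]
  | succ n ih =>
    have hd : d - (n + 1 : ℕ) = d - n - 1 := by push_cast; ring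
    intro t ht x
    rw [iteratedFDeriv_succ_eq_comp_left, Function.comp_apply, Function.comp_apply,
      hd, ih.fderiv t ht, map_smul]

theorem isBigO_norm_zpow [ProperSpace X] (hf : IsPosHomogeneous d f)
    (hcont : ContinuousOn f {0}ᶜ) : f =O[cobounded X] fun x => ‖x‖ ^ d := by
  obtain ⟨C, hC⟩ := (isCompact_sphere (0 : X) 1).exists_bound_of_continuousOn
    (hcont.mono fun x hx => ne_zero_of_mem_unit_sphere ⟨x, hx⟩)
  refine IsBigO.of_bound C ?_
  filter_upwards [Bornology.eventually_ne_cobounded 0] with x hx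
  have hnorm : 0 < ‖x‖ := norm_pos_iff.2 hx
  calc ‖f x‖ = ‖x‖ ^ d * ‖f (‖x‖⁻¹ • x)‖ := by
        rw [← abs_of_pos (zpow_pos hnorm d), ← Real.norm_eq_abs, ← norm_smul, ← hf _ hnorm,
          smul_inv_smul₀ hnorm.ne']
    _ ≤ C * ‖‖x‖ ^ d‖ := by
        rw [norm_zpow, norm_norm, mul_comm]
        gcongr
        exact hC _ (by simp [norm_smul, hnorm.ne'])

end IsPosHomogeneous

/-- The smooth functions on the punctured space that are `O(‖x‖^q)` at infinity together with all
their derivatives. -/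
def Decaying (X V : Type*) [NormedAddCommGroup X] [NormedSpace ℝ X] [NormedAddCommGroup V]
    [NormedSpace ℝ V] (q : ℤ) : Submodule ℝ (SmoothFn (punctured X) V) where
  carrier := {f | ∀ n, iteratedFDeriv ℝ n f =O[cobounded X] fun x => ‖x‖ ^ q}
  add_mem' {f g} hf hg n := by
    refine ((hf n).add (hg n)).congr' ?_ .rfl
    filter_upwards [Bornology.eventually_ne_cobounded 0] with x hx
    exact (iteratedFDeriv_add_apply ((SmoothFn.contDiffAt f hx).of_le (by exact_mod_cast le_top))
      ((SmoothFn.contDiffAt g hx).of_le (by exact_mod_cast le_top))).symm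
  zero_mem' n := (isBigO_zero _ _).congr_left fun x => (congrFun iteratedFDeriv_fun_zero x).symm
  smul_mem' c f hf n := by
    refine ((hf n).const_smul_left c).congr' ?_ .rfl
    filter_upwards [Bornology.eventually_ne_cobounded 0] with x hx
    exact (iteratedFDeriv_const_smul_apply
      ((SmoothFn.contDiffAt f hx).of_le (by exact_mod_cast le_top))).symm

namespace Decaying

variable {q : ℤ} {f : SmoothFn (punctured X) V}

theorem of_isPosHomogeneous [FiniteDimensional ℝ X] {d : ℤ} (hd : d ≤ q)
    (hf : IsPosHomogeneous d f) : f ∈ Decaying X V q := by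
  have := FiniteDimensional.proper_real X
  intro n
  have hcont : ContinuousOn (iteratedFDeriv ℝ n f) {0}ᶜ :=
    fun x hx => ((SmoothFn.contDiffAt f hx).continuousAt_iteratedFDeriv
      (by exact_mod_cast le_top)).continuousWithinAt
  exact ((hf.iteratedFDeriv n).isBigO_norm_zpow hcont).trans (isBigO_norm_zpow_of_le (by omega))

theorem dirDeriv_mem (hf : f ∈ Decaying X V q) (v : X) :
    SmoothFn.dirDeriv v f ∈ Decaying X V q := by
  let evalAt := ContinuousLinearMap.apply ℝ V v
  intro n
  refine IsBigO.trans (IsBigO.of_bound ‖evalAt‖ ?_) (hf (n + 1))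
  filter_upwards [Bornology.eventually_ne_cobounded 0] with x hx
  have hderiv : SmoothFn.dirDeriv v f =ᶠ[𝓝 x] evalAt ∘ fderiv ℝ f := by
    filter_upwards [(punctured X).isOpen.mem_nhds hx] with y hy
    exact SmoothFn.dirDeriv_apply v f hy
  have hsmooth : ContDiffAt ℝ n (fderiv ℝ f) x :=
    (SmoothFn.contDiffAt f hx).fderiv_right (by exact_mod_cast le_top)
  rw [(hderiv.iteratedFDeriv ℝ n).eq_of_nhds, ← norm_iteratedFDeriv_fderiv]
  exact evalAt.norm_iteratedFDeriv_comp_left hsmooth le_rfl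

theorem postcomp_mem (hf : f ∈ Decaying X V q) (A : V →L[ℝ] W) :
    SmoothFn.postcomp A f ∈ Decaying X W q := by
  intro n
  refine IsBigO.trans (IsBigO.of_bound ‖A‖ ?_) (hf n)
  filter_upwards [Bornology.eventually_ne_cobounded 0] with x hx
  exact A.norm_iteratedFDeriv_comp_left (SmoothFn.contDiffAt f hx) (by exact_mod_cast le_top)

theorem isBigO (hf : f ∈ Decaying X V q) : f =O[cobounded X] fun x => ‖x‖ ^ q := by
  simpa using (hf 0).norm_left

theorem isBigO_fderiv (hf : f ∈ Decaying X V q) :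
    fderiv ℝ f =O[cobounded X] fun x => ‖x‖ ^ q := by
  simpa using (hf 1).norm_left

end Decaying

end Homogeneous

/-! ### Periodization -/

theorem NormallyConvergentOn.summable {ι X V : Type*} [TopologicalSpace X] [NormedAddCommGroup V]
    [CompleteSpace V] {f : ι → X → V} {Ω : Set X} (h : NormallyConvergentOn f Ω) {x : X}
    (hx : x ∈ Ω) : Summable fun i => f i x := by
  obtain ⟨M, hM, hbound⟩ := h {x} (Set.singleton_subset_iff.2 hx) isCompact_singleton
  exact .of_norm_bounded hM fun i => hbound i x rfl

theorem NormallyConvergentOn.hasSumLocallyUniformlyOn {ι X V : Type*} [TopologicalSpace X]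
    [LocallyCompactSpace X] [NormedAddCommGroup V] [CompleteSpace V] {f : ι → X → V} {Ω : Set X}
    (hf : NormallyConvergentOn f Ω) (hΩ : IsOpen Ω) :
    HasSumLocallyUniformlyOn f (fun x => ∑' i, f i x) Ω := by
  refine hasSumLocallyUniformlyOn_of_forall_compact hΩ fun K hKΩ hK => ?_
  obtain ⟨M, hM, hbound⟩ := hf K hKΩ hK
  exact hasSumUniformlyOn_iff_tendstoUniformlyOn.2 (tendstoUniformlyOn_tsum hM hbound)

theorem NormallyConvergentOn.comp_equiv {ι κ X V : Type*} [TopologicalSpace X]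
    [NormedAddCommGroup V] {f : ι → X → V} {Ω : Set X} (h : NormallyConvergentOn f Ω)
    (σ : κ ≃ ι) : NormallyConvergentOn (fun j => f (σ j)) Ω := by
  intro K hKΩ hK
  obtain ⟨M, hM, hbound⟩ := h K hKΩ hK
  exact ⟨M ∘ σ, σ.summable_iff.2 hM, fun j => hbound (σ j)⟩

theorem exists_eventually_forall_norm_add_le {X V : Type*} [NormedAddCommGroup X]
    [NormedAddCommGroup V] {q : ℤ} (hq : q ≤ 0) {f : X → V}
    (hf : f =O[cobounded X] fun x => ‖x‖ ^ q) {K : Set X} (hK : Bornology.IsBounded K) :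
    ∃ C : ℝ, ∀ᶠ a in cobounded X, ∀ x ∈ K, ‖f (x + a)‖ ≤ C * ‖a‖ ^ q := by
  obtain ⟨C, hC, hbound⟩ := hf.exists_nonneg
  obtain ⟨ρ, -, hρ⟩ := Filter.hasBasis_cobounded_norm.eventually_iff.1 hbound.bound
  obtain ⟨R, hR⟩ := hK.exists_norm_le
  refine ⟨C * 2 ^ (-q), ?_⟩
  filter_upwards [tendsto_norm_cobounded_atTop.eventually_ge_atTop (R + ρ),
    tendsto_norm_cobounded_atTop.eventually_ge_atTop (2 * R),
    Bornology.eventually_ne_cobounded 0] with a hfar hdouble ha x hx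
  have hsub : ‖a‖ - ‖x‖ ≤ ‖x + a‖ := by
    simpa [add_comm] using norm_sub_norm_le a (-x)
  have hhalf : ‖a‖ / 2 ≤ ‖x + a‖ := by linarith [hR x hx]
  calc ‖f (x + a)‖ ≤ C * ‖x + a‖ ^ q := by
        simpa using hρ (show ρ ≤ ‖x + a‖ by linarith [hR x hx])
    _ ≤ C * (‖a‖ / 2) ^ q := by
        obtain ⟨n, rfl⟩ := Int.exists_eq_neg_ofNat hq
        simp only [zpow_neg, zpow_natCast]
        gcongr
    _ = C * 2 ^ (-q) * ‖a‖ ^ q := by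
        rw [div_zpow, zpow_neg]
        ring

section Periodization

variable {X V W : Type*} [NormedAddCommGroup X] {L : Submodule ℤ X} [DiscreteTopology L]

variable (L) in
/-- The complement of a lattice. -/
def latticeCompl : Opens X :=
  ⟨(L : Set X)ᶜ, (inferInstance : IsClosed (L.toAddSubgroup : Set X)).isOpen_compl⟩

theorem add_mem_punctured {x : X} (hx : x ∈ latticeCompl L) (a : L) : x + a ∈ punctured X :=
  fun h => hx (by simp [eq_neg_of_add_eq_zero_left h])

variable [NormedSpace ℝ X] [FiniteDimensional ℝ X] [NormedAddCommGroup V] {q : ℤ}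

theorem normallyConvergentOn_translates (hq : q < -Module.finrank ℤ L) {f : X → V}
    (hcont : ContinuousOn f {0}ᶜ) (hf : f =O[cobounded X] fun x => ‖x‖ ^ q) :
    NormallyConvergentOn (fun (a : L) x => f (x + a)) (latticeCompl L) := by
  classical
  intro K hKL hK
  have hbound (a : L) : ∃ b : ℝ, ∀ x ∈ K, ‖f (x + a)‖ ≤ b :=
    hK.exists_bound_of_continuousOn <| hcont.comp (by fun_prop) fun x hx =>
      add_mem_punctured (hKL hx) a
  choose b hb using hbound
  obtain ⟨C, hC⟩ := exists_eventually_forall_norm_add_le (by omega) hf hK.isBounded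
  have hfar : ∀ᶠ a : L in Filter.cofinite, ∀ x ∈ K, ‖f (x + a)‖ ≤ C * ‖a‖ ^ q := by
    have := FiniteDimensional.proper_real X
    rw [Metric.cobounded_eq_cocompact] at hC
    exact (L.toAddSubgroup.tendsto_coe_cofinite_of_discrete
      (isDiscrete_iff_discreteTopology.2 ‹_›)).eventually hC
  refine ⟨fun a => if ∀ x ∈ K, ‖f (x + a)‖ ≤ C * ‖a‖ ^ q then C * ‖a‖ ^ q else b a, ?_, ?_⟩
  · refine ((ZLattice.summable_norm_zpow L q hq).mul_left C).congr_cofinite ?_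
    filter_upwards [hfar] with a ha
    rw [if_pos ha]
  · intro a x hx
    dsimp only
    split_ifs with ha
    exacts [ha x hx, hb a x hx]

variable (L) in
/-- The sum of a function over the lattice translates of a point. -/
def latticeSum (f : X → V) (x : X) : V := ∑' a : L, f (x + a)

variable [NormedSpace ℝ V] [NormedAddCommGroup W] [NormedSpace ℝ W]
  {f : SmoothFn (punctured X) V} (hf : f ∈ Decaying X V q)
  (hq : q < -Module.finrank ℤ L)

section
include hf hq

theorem Decaying.normallyConvergentOn :
    NormallyConvergentOn (fun (a : L) x => f (x + a)) (latticeCompl L) :=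
  normallyConvergentOn_translates hq (SmoothFn.contDiffOn f).continuousOn (isBigO hf)

theorem Decaying.normallyConvergentOn_fderiv :
    NormallyConvergentOn (fun (a : L) x => fderiv ℝ f (x + a)) (latticeCompl L) :=
  normallyConvergentOn_translates hq ((SmoothFn.contDiffOn f).continuousOn_fderiv_of_isOpen
    (punctured X).isOpen (by simp)) (isBigO_fderiv hf)

variable [CompleteSpace V]

theorem hasFDerivAt_latticeSum {x : X} (hx : x ∈ latticeCompl L) :
    HasFDerivAt (latticeSum L f) (latticeSum L (fderiv ℝ f) x) x := by
  have := FiniteDimensional.proper_real X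
  obtain ⟨r, hr, hball⟩ := Metric.nhds_basis_closedBall.mem_iff.1
    ((latticeCompl L).isOpen.mem_nhds hx)
  obtain ⟨M, hM, hbound⟩ :=
    Decaying.normallyConvergentOn_fderiv hf hq _ hball (isCompact_closedBall x r)
  have hsub : Metric.ball x r ⊆ Metric.closedBall x r := Metric.ball_subset_closedBall
  have hx_mem := Metric.mem_ball_self (x := x) hr
  refine hasFDerivAt_tsum_of_isPreconnected hM Metric.isOpen_ball
    (convex_ball x r).isPreconnected (fun a y hy => ?_) (fun a y hy => hbound a y (hsub hy))
    hx_mem ((Decaying.normallyConvergentOn hf hq).summable hx) hx_mem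
  exact (hasFDerivAt_comp_add_right (a : X)).2
    (SmoothFn.differentiableAt f (add_mem_punctured (hball (hsub hy)) a)).hasFDerivAt

theorem latticeSum_fderiv_apply {x : X} (hx : x ∈ latticeCompl L) (v : X) :
    latticeSum L (fderiv ℝ f) x v = latticeSum L (SmoothFn.dirDeriv v f) x := by
  have hsum := (Decaying.normallyConvergentOn_fderiv hf hq).summable hx
  refine ((ContinuousLinearMap.apply ℝ V v).map_tsum hsum).trans (tsum_congr fun a => ?_)
  exact (SmoothFn.dirDeriv_apply v f (add_mem_punctured hx a)).symm

theorem contDiffOn_latticeSum : ContDiffOn ℝ ∞ (latticeSum L f) (latticeCompl L) := by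
  refine contDiffOn_infty.2 fun n => ?_
  induction n generalizing f with
  | zero =>
    exact contDiffOn_zero.2 fun x hx =>
      (hasFDerivAt_latticeSum hf hq hx).continuousAt.continuousWithinAt
  | succ n ih =>
    rw [Nat.cast_succ]
    refine (contDiffOn_succ_iff_fderiv_of_isOpen (latticeCompl L).isOpen).2 ⟨fun x hx =>
      (hasFDerivAt_latticeSum hf hq hx).differentiableAt.differentiableWithinAt,
      fun h => absurd h (by simp), contDiffOn_clm_apply.2 fun v => ?_⟩
    refine (ih (Decaying.dirDeriv_mem hf v)).congr fun x hx => ?_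
    rw [(hasFDerivAt_latticeSum hf hq hx).fderiv, latticeSum_fderiv_apply hf hq hx]

end

variable [CompleteSpace V] [CompleteSpace W]

/-- Summation over the lattice translates, as a linear map. -/
def periodize : Decaying X V q →ₗ[ℝ] SmoothFn (latticeCompl L) V where
  toFun f := SmoothFn.ofContDiffOn (latticeSum L f.1) (contDiffOn_latticeSum f.2 hq)
  map_add' f g := SmoothFn.ext_on fun x hx => by
    simp only [SmoothFn.add_apply, SmoothFn.ofContDiffOn_apply _ hx]
    exact ((Decaying.normallyConvergentOn f.2 hq).summable hx).tsum_add
      ((Decaying.normallyConvergentOn g.2 hq).summable hx)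
  map_smul' c f := SmoothFn.ext_on fun x hx => by
    simp only [SmoothFn.smul_apply, SmoothFn.ofContDiffOn_apply _ hx, RingHom.id_apply]
    exact ((Decaying.normallyConvergentOn f.2 hq).summable hx).tsum_const_smul c

theorem periodize_apply (f : Decaying X V q) {x : X} (hx : x ∈ latticeCompl L) :
    periodize hq f x = latticeSum L f.1 x :=
  SmoothFn.ofContDiffOn_apply (contDiffOn_latticeSum f.2 hq) hx

theorem periodize_dirDeriv (v : X) :
    periodize hq ⟨SmoothFn.dirDeriv v f, Decaying.dirDeriv_mem hf v⟩ =
      SmoothFn.dirDeriv v (periodize hq ⟨f, hf⟩) := by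
  refine SmoothFn.ext_on fun x hx => ?_
  rw [periodize_apply hq _ hx, SmoothFn.dirDeriv_apply_of_eqOn
    (fun y hy => (periodize_apply hq ⟨f, hf⟩ hy).symm) v hx,
    (hasFDerivAt_latticeSum hf hq hx).fderiv, latticeSum_fderiv_apply hf hq hx]

theorem periodize_postcomp (A : V →L[ℝ] W) :
    periodize hq ⟨SmoothFn.postcomp A f, Decaying.postcomp_mem hf A⟩ =
      SmoothFn.postcomp A (periodize hq ⟨f, hf⟩) := by
  refine SmoothFn.ext_on fun x hx => ?_
  rw [SmoothFn.postcomp_apply, periodize_apply hq _ hx, periodize_apply hq _ hx]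
  exact (A.map_tsum ((Decaying.normallyConvergentOn hf hq).summable hx)).symm

end Periodization

section DiracSystem

variable {m : ℕ} {q : ℤ}

/-- The derivatives and the multiplications restrict to the decaying functions. -/
def decayingSystem (m : ℕ) (q : ℤ) : DiracSystem m (Decaying (E m) (Cl m) q) :=
  (SmoothFn.diracSystem _).restrict _ (fun i _ hf => Decaying.dirDeriv_mem hf (e i))
    fun _ _ hf => Decaying.postcomp_mem hf _

variable {L : Submodule ℤ (E m)} [DiscreteTopology L] (hq : q < -Module.finrank ℤ L)

theorem intertwines_periodize : DiracSystem.Intertwines (periodize hq) (decayingSystem m q)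
    (SmoothFn.diracSystem (latticeCompl L)) where
  map_deriv i f := periodize_dirDeriv f.2 hq (e i)
  map_mulBasis _ f := periodize_postcomp f.2 hq _

theorem higherSpin_periodize (k : ℕ) {b : E m →ₗ[ℝ] Decaying (E m) (Cl m) q} {u : E m}
    (hb : (SmoothFn.diracSystem _).higherSpin k (Submodule.subtype _ ∘ₗ b) u = 0) :
    (SmoothFn.diracSystem (latticeCompl L)).higherSpin k (periodize hq ∘ₗ b) u = 0 := by
  have hzero : (decayingSystem m q).higherSpin k b u = 0 := Subtype.ext <|
    (DiracSystem.Intertwines.map_higherSpin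
      (DiracSystem.intertwines_subtype_restrict _ _ _) k b u).trans hb
  rw [← (intertwines_periodize hq).map_higherSpin, hzero, map_zero]

end DiracSystem

section Lattice

variable {m l : ℕ}

variable (m l) in
/-- The lattice `ℤ^l` as a `ℤ`-submodule of `ℝ^m`. -/
def zLattice : Submodule ℤ (E m) := (latticeVec m l).toIntLinearMap.range

theorem zLattice_le_span_basisFun :
    zLattice m l ≤ Submodule.span ℤ (Set.range (EuclideanSpace.basisFun (Fin m) ℝ).toBasis) := by
  rintro _ ⟨n, rfl⟩
  refine (Module.Basis.mem_span_iff_repr_mem ℤ _ _).2 fun j => ?_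
  by_cases hj : (j : ℕ) < l <;> simp [latticeVec, hj]

instance : DiscreteTopology (zLattice m l) :=
  DiscreteTopology.of_subset
    (inferInstanceAs <| DiscreteTopology <|
      Submodule.span ℤ (Set.range (EuclideanSpace.basisFun (Fin m) ℝ).toBasis))
    zLattice_le_span_basisFun

theorem finrank_zLattice_le : Module.finrank ℤ (zLattice m l) ≤ l :=
  (LinearMap.finrank_range_le _).trans_eq (Module.finrank_fin_fun ℤ)

theorem latticeVec_injective (hlm : l ≤ m) : Function.Injective (latticeVec m l) := by
  intro a b hab
  ext i
  simpa [latticeVec] using congrArg (fun x : E m => x ⟨i, i.2.trans_le hlm⟩) hab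

/-- The parametrization of `ℤ^l` by its coordinates. -/
def latticeEquiv (hlm : l ≤ m) : (Fin l → ℤ) ≃ zLattice m l :=
  Equiv.ofInjective _ (latticeVec_injective hlm)

theorem tsum_latticeVec {V : Type*} [NormedAddCommGroup V] (hlm : l ≤ m) (f : E m → V) (x : E m) :
    ∑' n, f (x + latticeVec m l n) = latticeSum (zLattice m l) f x :=
  (latticeEquiv hlm).tsum_eq fun a => f (x + a)

end Lattice

/-! ### Second moments of the sphere -/

section Sphere

open MeasureTheory Module

variable {X V : Type*} [NormedAddCommGroup X] [InnerProductSpace ℝ X]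

/-- The action of a linear isometry on the unit sphere. -/
def sphereHomeomorph (T : X ≃ₗᵢ[ℝ] X) : Metric.sphere (0 : X) 1 ≃ₜ Metric.sphere (0 : X) 1 :=
  T.toHomeomorph.subtype fun x => by simp

@[simp]
theorem coe_sphereHomeomorph (T : X ≃ₗᵢ[ℝ] X) (u : Metric.sphere (0 : X) 1) :
    (sphereHomeomorph T u : X) = T u := rfl

variable [MeasurableSpace X] [BorelSpace X] [FiniteDimensional ℝ X]

variable (X) in
/-- The surface measure of the unit sphere. -/
abbrev surface : Measure (Metric.sphere (0 : X) 1) := (volume : Measure X).toSphere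

open scoped Pointwise in
theorem measurePreserving_sphereHomeomorph (T : X ≃ₗᵢ[ℝ] X) :
    MeasurePreserving (sphereHomeomorph T) (surface X) (surface X) := by
  have hmeas := (sphereHomeomorph T).continuous.measurable
  refine ⟨hmeas, Measure.ext fun s hs => ?_⟩
  have hcone : Set.Ioo (0 : ℝ) 1 • (Subtype.val '' (sphereHomeomorph T ⁻¹' s)) =
      T ⁻¹' (Set.Ioo (0 : ℝ) 1 • (Subtype.val '' s)) := by
    ext x
    simp only [Set.mem_smul, Set.mem_image, Set.mem_preimage]
    constructor
    · rintro ⟨r, hr, _, ⟨u, hu, rfl⟩, rfl⟩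
      exact ⟨r, hr, _, ⟨_, hu, rfl⟩, by simp⟩
    · rintro ⟨r, hr, _, ⟨u, hu, rfl⟩, hx⟩
      exact ⟨r, hr, _, ⟨(sphereHomeomorph T).symm u, by simpa, rfl⟩, T.injective <| by
        rw [map_smul, ← coe_sphereHomeomorph, Homeomorph.apply_symm_apply, hx]⟩
  rw [Measure.map_apply hmeas hs, Measure.toSphere_apply' _ hs,
    Measure.toSphere_apply' _ (hmeas hs), hcone,
    T.measurePreserving.measure_preimage_emb T.toHomeomorph.measurableEmbedding]

theorem integral_comp_sphereHomeomorph [NormedAddCommGroup V] [NormedSpace ℝ V] (T : X ≃ₗᵢ[ℝ] X)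
    (f : Metric.sphere (0 : X) 1 → V) :
    ∫ u, f (sphereHomeomorph T u) ∂surface X = ∫ u, f u ∂surface X :=
  (measurePreserving_sphereHomeomorph T).integral_comp
    (sphereHomeomorph T).measurableEmbedding f

theorem integrable_inner_mul_inner (x y : X) :
    Integrable (fun u : Metric.sphere (0 : X) 1 => ⟪(u : X), x⟫_ℝ * ⟪(u : X), y⟫_ℝ)
      (surface X) :=
  Continuous.integrable_of_hasCompactSupport (by fun_prop) (.of_compactSpace _)

theorem integral_inner_mul_inner_of_inner_eq_zero {x y : X} (hxy : ⟪x, y⟫_ℝ = 0) :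
    ∫ u : Metric.sphere (0 : X) 1, ⟪(u : X), x⟫_ℝ * ⟪(u : X), y⟫_ℝ ∂surface X = 0 := by
  let R := (ℝ ∙ x)ᗮ.reflection
  have hx (u : X) : ⟪R u, x⟫_ℝ = -⟪u, x⟫_ℝ := by
    rw [← R.inner_map_map u x, Submodule.reflection_orthogonalComplement_singleton_eq_neg,
      inner_neg_right, neg_neg]
  have hy (u : X) : ⟪R u, y⟫_ℝ = ⟪u, y⟫_ℝ := by
    rw [← R.inner_map_map u y, Submodule.reflection_mem_subspace_eq_self
      (Submodule.mem_orthogonal_singleton_iff_inner_right.2 hxy)]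
  have hodd := integral_comp_sphereHomeomorph R fun u => ⟪(u : X), x⟫_ℝ * ⟪(u : X), y⟫_ℝ
  simp only [coe_sphereHomeomorph, hx, hy, neg_mul, integral_neg] at hodd
  linarith

theorem integral_inner_mul_self_eq_of_norm_eq {x y : X} (hxy : ‖x‖ = ‖y‖) :
    ∫ u : Metric.sphere (0 : X) 1, ⟪(u : X), x⟫_ℝ * ⟪(u : X), x⟫_ℝ ∂surface X =
      ∫ u : Metric.sphere (0 : X) 1, ⟪(u : X), y⟫_ℝ * ⟪(u : X), y⟫_ℝ ∂surface X := by
  let R := (ℝ ∙ (x - y))ᗮ.reflection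
  have hy (u : X) : ⟪R u, y⟫_ℝ = ⟪u, x⟫_ℝ := by
    rw [← Submodule.reflection_sub hxy, LinearIsometryEquiv.inner_map_map]
  rw [← integral_comp_sphereHomeomorph R fun u => ⟪(u : X), y⟫_ℝ * ⟪(u : X), y⟫_ℝ]
  simp only [coe_sphereHomeomorph, hy]

variable (X) in
/-- The common value of the integrals of `⟪u, x⟫²` over the unit sphere, for unit vectors `x`. -/
def sphereMoment : ℝ := (surface X).real Set.univ / finrank ℝ X

variable (X) in
theorem sphereMoment_ne_zero [Nontrivial X] : sphereMoment X ≠ 0 :=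
  have : NeZero (surface X) := ⟨Measure.toSphere_ne_zero _⟩
  div_ne_zero measureReal_univ_ne_zero (Nat.cast_ne_zero.2 finrank_pos.ne')

variable {ι : Type*} [Fintype ι] (b : OrthonormalBasis ι ℝ X)

theorem integral_inner_mul_self_orthonormalBasis (i : ι) :
    ∫ u : Metric.sphere (0 : X) 1, ⟪(u : X), b i⟫_ℝ * ⟪(u : X), b i⟫_ℝ ∂surface X =
      sphereMoment X := by
  have hcard : finrank ℝ X = Fintype.card ι := finrank_eq_card_basis b.toBasis
  have : Nonempty ι := ⟨i⟩
  have htotal : ∑ j, ∫ u : Metric.sphere (0 : X) 1, ⟪(u : X), b j⟫_ℝ * ⟪(u : X), b j⟫_ℝ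
      ∂surface X = (surface X).real Set.univ := by
    rw [← integral_finsetSum _ fun j _ => integrable_inner_mul_inner (b j) (b j)]
    have hnorm (u : Metric.sphere (0 : X) 1) :
        ∑ j, ⟪(u : X), b j⟫_ℝ * ⟪(u : X), b j⟫_ℝ = 1 := by
      simpa [real_inner_comm, sq] using b.sum_sq_inner_left (u : X)
    simp [hnorm]
  rw [sphereMoment, eq_div_iff (by simp [hcard]), ← htotal, Finset.sum_congr rfl fun j _ =>
    integral_inner_mul_self_eq_of_norm_eq (show ‖b j‖ = ‖b i‖ by simp)]
  simp [hcard, mul_comm]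

theorem integral_bilinear_self [NormedAddCommGroup V] [NormedSpace ℝ V] [CompleteSpace V]
    (B : X →ₗ[ℝ] X →ₗ[ℝ] V) :
    ∫ u : Metric.sphere (0 : X) 1, B u u ∂surface X = sphereMoment X • ∑ i, B (b i) (b i) := by
  classical
  have hexpand (u : Metric.sphere (0 : X) 1) :
      B u u = ∑ i, ∑ j, (⟪(u : X), b i⟫_ℝ * ⟪(u : X), b j⟫_ℝ) • B (b i) (b j) := by
    conv_lhs => rw [← b.sum_repr' (u : X)]
    simp only [map_sum, LinearMap.sum_apply, map_smul, LinearMap.smul_apply, Finset.smul_sum,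
      smul_smul, real_inner_comm (u : X)]
    rw [Finset.sum_comm]
    simp only [mul_comm]
  have hmoment (i j : ι) : ∫ u : Metric.sphere (0 : X) 1, ⟪(u : X), b i⟫_ℝ * ⟪(u : X), b j⟫_ℝ
      ∂surface X = if i = j then sphereMoment X else 0 := by
    split_ifs with hij
    · exact hij ▸ integral_inner_mul_self_orthonormalBasis b i
    · exact integral_inner_mul_inner_of_inner_eq_zero (b.orthonormal.2 hij)
  have hint (i j : ι) := (integrable_inner_mul_inner (b i) (b j)).smul_const (B (b i) (b j))
  rw [integral_congr_ae (.of_forall hexpand)]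
  rw [integral_finsetSum _ fun i _ => integrable_finsetSum _ fun j _ => hint i j,
    Finset.smul_sum]
  refine Finset.sum_congr rfl fun i _ => ?_
  rw [integral_finsetSum _ fun j _ => hint i j]
  simp [integral_smul_const, hmoment]

end Sphere

/-! ### The reproducing kernel -/

section ReproducingKernel

variable {m k : ℕ}

theorem IsHomogeneousDegreeOne.exists_linear {f : E m → Cl m} (hf : IsHomogeneousDegreeOne f) :
    ∃ T : E m →ₗ[ℝ] Cl m, f = T := by
  obtain ⟨a, ha⟩ := hf
  refine ⟨{ toFun := f, map_add' := fun u v => ?_, map_smul' := fun c u => ?_ }, rfl⟩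
  · simp [ha, add_smul, Finset.sum_add_distrib]
  · simp [ha, Finset.smul_sum, smul_smul]

theorem isHomogeneousDegreeOne_linear (T : E m →ₗ[ℝ] Cl m) : IsHomogeneousDegreeOne T :=
  ⟨fun i => T (e i), fun u => (sum_smul_map_e T u).symm⟩

/-- The condition on a linear function `T` to belong to `𝒫_k`: it is left monogenic if `k` is odd
(harmonicity is automatic). -/
def IsSpinOneLinear (k : ℕ) (T : E m →ₗ[ℝ] Cl m) : Prop :=
  ¬Even k → ∑ i, vec (e i) * T (e i) = 0

theorem IsSpinOneLinear.smul {T : E m →ₗ[ℝ] Cl m} (hT : IsSpinOneLinear k T) (c : ℝ) :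
    IsSpinOneLinear k (c • T) := fun hk => by
  simp only [LinearMap.smul_apply, mul_smul_comm, ← Finset.smul_sum, hT hk, smul_zero]

theorem isSpinOne_linear_iff (T : E m →ₗ[ℝ] Cl m) : IsSpinOne k T ↔ IsSpinOneLinear k T := by
  have hT (i : Fin m) : partialE i T = fun _ => T (e i) := funext (partialE_linear T i)
  have hconst (i : Fin m) (c : Cl m) (u : E m) : partialE i (fun _ => c) u = 0 :=
    ((hasFDerivAt_const c u).hasLineDerivAt (e i)).lineDeriv
  by_cases hk : Even k <;>
    simp [IsSpinOne, IsSpinOneLinear, hk, hT, hconst, isHomogeneousDegreeOne_linear]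

theorem IsSpinOne.exists_linear {f : E m → Cl m} (hf : IsSpinOne k f) :
    ∃ T : E m →ₗ[ℝ] Cl m, f = T ∧ IsSpinOneLinear k T := by
  obtain ⟨T, rfl⟩ := hf.1.exists_linear
  exact ⟨T, rfl, (isSpinOne_linear_iff T).1 hf⟩

theorem integral_star_mul (T S : E m →ₗ[ℝ] Cl m) :
    ∫ u : Metric.sphere (0 : E m) 1, star (T u) * S u ∂surface (E m) =
      sphereMoment (E m) • ∑ i, star (T (e i)) * S (e i) := by
  let conj : Cl m →ₗ[ℝ] Cl m :=
    CliffordAlgebra.reverse ∘ₗ CliffordAlgebra.involute.toLinearMap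
  simpa [conj, e, CliffordAlgebra.star_def] using
    integral_bilinear_self (EuclideanSpace.basisFun (Fin m) ℝ)
      ((LinearMap.mul ℝ (Cl m)).compl₁₂ (conj ∘ₗ T) S)

theorem sum_vec_mul_vec : ∑ i : Fin m, vec (e i) * vec (e i) = -(m : ℝ) • (1 : Cl m) := by
  have hnorm (i : Fin m) : ‖e i‖ = 1 := by simp [e]
  simp only [vec_mul_self, hnorm]
  simp [Algebra.algebraMap_eq_smul_one, Nat.cast_smul_eq_nsmul]

/-- The reproducing kernel `Z_1(u, v)` as a linear function of `u`. It is the orthogonal projection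
to `𝒫_k` of a multiple of `⟪u, v⟫`. -/
def spinOneKernel (k : ℕ) (v : E m) : E m →ₗ[ℝ] Cl m :=
  (sphereMoment (E m))⁻¹ • ((innerₗ (E m) v).smulRight (1 : Cl m) +
    if Even k then 0
    else (m : ℝ)⁻¹ • (LinearMap.mulRight ℝ (vec v) ∘ₗ CliffordAlgebra.ι (negSq m)))

theorem star_spinOneKernel_e (k : ℕ) (v : E m) (i : Fin m) :
    star (spinOneKernel k v (e i)) = (sphereMoment (E m))⁻¹ • (v i • (1 : Cl m) +
      if Even k then 0 else (m : ℝ)⁻¹ • (vec v * vec (e i))) := by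
  split_ifs with hk <;>
    simp [spinOneKernel, hk, inner_e, CliffordAlgebra.star_smul, CliffordAlgebra.star_ι]

variable [NeZero m]

theorem isSpinOneLinear_spinOneKernel (k : ℕ) (v : E m) :
    IsSpinOneLinear k (spinOneKernel k v) := by
  intro hk
  have hm : (m : ℝ) ≠ 0 := NeZero.ne _
  have hterm (i : Fin m) : vec (e i) * spinOneKernel k v (e i) = (sphereMoment (E m))⁻¹ •
      (v i • vec (e i) + (m : ℝ)⁻¹ • (vec (e i) * vec (e i) * vec v)) := by
    rw [mul_assoc]
    simp [spinOneKernel, hk, inner_e, mul_add]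
  simp only [hterm, ← Finset.smul_sum, Finset.sum_add_distrib, sum_smul_map_e, ← Finset.sum_mul,
    sum_vec_mul_vec]
  simp [hm]

theorem isSpinOne_spinOneKernel (k : ℕ) (v : E m) : IsSpinOne k (spinOneKernel k v) :=
  (isSpinOne_linear_iff _).2 (isSpinOneLinear_spinOneKernel k v)

theorem sphereMoment_smul_sum_star_spinOneKernel_mul {T : E m →ₗ[ℝ] Cl m}
    (hT : IsSpinOneLinear k T) (v : E m) :
    sphereMoment (E m) • ∑ i, star (spinOneKernel k v (e i)) * T (e i) = T v := by
  simp only [star_spinOneKernel_e, smul_mul_assoc, ← Finset.smul_sum]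
  rw [smul_inv_smul₀ (sphereMoment_ne_zero _)]
  simp only [add_mul, Finset.sum_add_distrib, smul_mul_assoc, one_mul, sum_smul_map_e]
  split_ifs with hk
  · simp
  · simp only [smul_mul_assoc, mul_assoc, ← Finset.smul_sum, ← Finset.mul_sum, hT hk]
    simp

theorem isReproducingKernel_spinOneKernel (k : ℕ) :
    IsReproducingKernel m k fun u v => spinOneKernel k v u where
  mem := isSpinOne_spinOneKernel k
  reproducing f hf v := by
    obtain ⟨T, rfl, hT⟩ := hf.exists_linear
    exact (integral_star_mul _ T).trans (sphereMoment_smul_sum_star_spinOneKernel_mul hT v)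

namespace IsReproducingKernel

variable {Z : E m → E m → Cl m}

theorem eq_star_spinOneKernel (hZ : IsReproducingKernel m k Z) (u v : E m) :
    Z u v = star (spinOneKernel k u v) := by
  obtain ⟨T, hT, hTmem⟩ := (hZ.mem v).exists_linear
  have hrepr := hZ.reproducing _ (isSpinOne_spinOneKernel k u) v
  simp only [fun w => congrFun hT w] at hrepr
  rw [integral_star_mul] at hrepr
  rw [congrFun hT u, ← sphereMoment_smul_sum_star_spinOneKernel_mul hTmem u, ← hrepr,
    CliffordAlgebra.star_smul, star_sum]
  simp only [star_mul, star_star]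

theorem eq_spinOneKernel (hZ : IsReproducingKernel m k Z) :
    Z = fun u v => spinOneKernel k v u := by
  funext u v
  rw [hZ.eq_star_spinOneKernel,
    ← (isReproducingKernel_spinOneKernel k).eq_star_spinOneKernel]

end IsReproducingKernel

theorem existsUnique_isReproducingKernel (m k : ℕ) [NeZero m] :
    ∃! Z : E m → E m → Cl m, IsReproducingKernel m k Z :=
  ⟨_, isReproducingKernel_spinOneKernel k, fun _ hZ => hZ.eq_spinOneKernel⟩

end ReproducingKernel

/-! ### The kernels `E_{1,k}` and their periodizations -/

section FundamentalSolution

variable {m k : ℕ}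

/-- The function `G_k(x) w(xux/‖x‖²)` of `x ≠ 0`, linear in `u`. -/
def fundSolFn (k : ℕ) (w : E m →ₗ[ℝ] Cl m) : E m →ₗ[ℝ] SmoothFn (punctured (E m)) (Cl m) :=
  if Even k then scalarKernel (k - m) w.toContinuousLinearMap
  else spinorKernel (k - m - 1) w.toContinuousLinearMap

theorem fundSolFn_apply (w : E m →ₗ[ℝ] Cl m) (u : E m) {x : E m} (hx : x ≠ 0) :
    fundSolFn k w u x = G m k x * w (sandwich x u) := by
  unfold fundSolFn G
  split_ifs
  · rw [scalarKernel_apply _ _ u hx, ← Algebra.smul_def]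
    rfl
  · rw [spinorKernel_apply _ _ u hx, smul_mul_assoc]
    rfl

theorem fundSol_eq_fundSolFn (c₁ : ℝ) {Z : E m → E m → Cl m} {v : E m} {w : E m →ₗ[ℝ] Cl m}
    (hZ : ∀ u, Z u v = w u) (u : E m) {x : E m} (hx : x ≠ 0) :
    fundSol m k c₁ Z x u v = fundSolFn k (c₁ • w) u x := by
  rw [fundSolFn_apply _ u hx, fundSol, hZ, LinearMap.smul_apply, mul_smul_comm]

theorem sandwich_smul {t : ℝ} (ht : t ≠ 0) (x u : E m) : sandwich (t • x) u = sandwich x u := by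
  simp only [sandwich, norm_smul, inner_smul_left, smul_smul, mul_pow, Real.norm_eq_abs, sq_abs,
    conj_trivial]
  congr 2
  field_simp

theorem isPosHomogeneous_G (m k : ℕ) : IsPosHomogeneous (k - m : ℤ) (G m k) := by
  intro t ht x
  unfold G
  split_ifs
  · simp only [norm_smul, Real.norm_of_nonneg ht.le, mul_zpow, map_mul, Algebra.smul_def]
  · rw [norm_smul, Real.norm_of_nonneg ht.le, mul_zpow, vec, map_smul, smul_smul, smul_smul,
      zpow_sub_one₀ ht.ne']
    congr 1
    field_simp

theorem isPosHomogeneous_fundSolFn (w : E m →ₗ[ℝ] Cl m) (u : E m) :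
    IsPosHomogeneous (k - m : ℤ) (fundSolFn k w u) := by
  intro t ht x
  obtain rfl | hx := eq_or_ne x 0
  · have hzero : fundSolFn k w u 0 = 0 := SmoothFn.eq_zero_of_notMem _ fun h => h rfl
    rw [smul_zero, hzero, smul_zero]
  · rw [fundSolFn_apply w u hx, fundSolFn_apply w u (smul_ne_zero ht.ne' hx),
      isPosHomogeneous_G m k t ht, sandwich_smul ht.ne', smul_mul_assoc]

theorem higherSpin_fundSolFn [NeZero m] (hk : 1 ≤ k) {w : E m →ₗ[ℝ] Cl m}
    (hw : IsSpinOneLinear k w) (u : E m) :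
    (SmoothFn.diracSystem _).higherSpin k (fundSolFn k w) u = 0 := by
  unfold DiracSystem.higherSpin fundSolFn
  split_ifs with heven
  · obtain ⟨n, hn⟩ : ∃ n, k = 2 * (n + 1) := ⟨k / 2 - 1, by grind⟩
    rw [hn, Nat.mul_div_cancel_left _ two_pos]
    exact bosonic_scalarKernel n (by push_cast; ring) _ u
  · obtain ⟨n, rfl⟩ := Nat.not_even_iff_odd.1 heven
    rw [show (2 * n + 1 + 1) / 2 = n + 1 by omega]
    exact fermionic_spinorKernel (hw heven) n (by push_cast; ring) u

theorem sum_mulLeft_fundSolFn (hk : ¬Even k) {w : E m →ₗ[ℝ] Cl m} (hw : IsSpinOneLinear k w) :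
    ∑ i, SmoothFn.mulLeft (vec (e i)) (fundSolFn k w (e i)) = 0 := by
  simp only [fundSolFn, if_neg hk]
  exact sum_mulLeft_spinorKernel (hw hk) _

end FundamentalSolution

theorem add_latticeVec_ne_zero {m l : ℕ} {x : E m} (hx : x ∉ lattice m l) (n : Fin l → ℤ) :
    x + latticeVec m l n ≠ 0 :=
  add_mem_punctured (L := zLattice m l) hx ⟨_, n, rfl⟩

section Cotangent

variable {m k l : ℕ} (hlm : l + k + 1 ≤ m)

/-- The function `G_k(x) w(xux/‖x‖²)` of `x ≠ 0` as a decaying function. -/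
def decayingFundSol (k : ℕ) (w : E m →ₗ[ℝ] Cl m) : E m →ₗ[ℝ] Decaying (E m) (Cl m) (k - m) :=
  (fundSolFn k w).codRestrict _ fun u =>
    Decaying.of_isPosHomogeneous le_rfl (isPosHomogeneous_fundSolFn w u)

include hlm in
theorem sub_lt_neg_finrank_zLattice : (k - m : ℤ) < -Module.finrank ℤ (zLattice m l) := by
  have := finrank_zLattice_le (m := m) (l := l)
  omega

/-- The periodization of `G_k(x) w(xux/‖x‖²)`. -/
def cotFn (w : E m →ₗ[ℝ] Cl m) : E m →ₗ[ℝ] SmoothFn (latticeCompl (zLattice m l)) (Cl m) :=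
  periodize (sub_lt_neg_finrank_zLattice hlm) ∘ₗ decayingFundSol k w

theorem isSpinOneLinear_eval_cotFn {w : E m →ₗ[ℝ] Cl m} (hw : IsSpinOneLinear k w) (x : E m) :
    IsSpinOneLinear k (SmoothFn.eval x ∘ₗ cotFn hlm w) := by
  intro hk
  have hzero : ∑ i, SmoothFn.mulLeft (vec (e i)) (cotFn hlm w (e i)) = 0 := by
    have hdecay (i : Fin m) := periodize_postcomp (decayingFundSol k w (e i)).2
      (sub_lt_neg_finrank_zLattice hlm) (LinearMap.mulLeft ℝ (vec (e i))).toContinuousLinearMap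
    refine (Finset.sum_congr rfl fun i _ => (hdecay i).symm).trans ?_
    rw [← map_sum]
    refine (congrArg _ (Subtype.ext ?_)).trans (map_zero _)
    rw [AddSubmonoidClass.coe_finsetSum]
    exact sum_mulLeft_fundSolFn hk hw
  exact (map_sum (SmoothFn.eval x) _ _).symm.trans
    ((congrArg (SmoothFn.eval x) hzero).trans (map_zero _))

theorem higherSpin_cotFn (hk : 1 ≤ k) {w : E m →ₗ[ℝ] Cl m} (hw : IsSpinOneLinear k w) (u : E m) :
    (SmoothFn.diracSystem _).higherSpin k (cotFn hlm w) u = 0 :=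
  have : NeZero m := ⟨by omega⟩
  higherSpin_periodize _ k (higherSpin_fundSolFn hk hw u)

variable (c₁ : ℝ) {Z : E m → E m → Cl m} {v : E m}

theorem represents_cot {w : E m →ₗ[ℝ] Cl m} (hZ : ∀ u, Z u v = w u) :
    SmoothFn.Represents (fun x u => cot m k l c₁ Z x u v) (cotFn hlm (c₁ • w)) := by
  intro x hx u
  rw [cotFn, LinearMap.comp_apply, periodize_apply _ _ hx, ← tsum_latticeVec (by omega)]
  exact tsum_congr fun n => fundSol_eq_fundSolFn c₁ hZ u (add_latticeVec_ne_zero hx n)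

theorem exists_represents_cot (hZ : IsSpinOne k fun u => Z u v) :
    ∃ w, IsSpinOneLinear k w ∧
      SmoothFn.Represents (fun x u => cot m k l c₁ Z x u v) (cotFn hlm w) := by
  obtain ⟨w, hw, hspin⟩ := hZ.exists_linear
  exact ⟨c₁ • w, hspin.smul c₁, represents_cot hlm c₁ (congrFun hw)⟩

include hlm

theorem normallyConvergentOn_fundSol (hZ : IsHomogeneousDegreeOne fun u => Z u v) (u : E m) :
    NormallyConvergentOn
      (fun (n : Fin l → ℤ) x => fundSol m k c₁ Z (x + latticeVec m l n) u v)
      (lattice m l : Set (E m))ᶜ := by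
  obtain ⟨w, hw⟩ := hZ.exists_linear
  intro K hKs hK
  obtain ⟨M, hM, hbound⟩ := ((Decaying.normallyConvergentOn (decayingFundSol k (c₁ • w) u).2
    (sub_lt_neg_finrank_zLattice hlm)).comp_equiv (latticeEquiv (by omega))) K hKs hK
  refine ⟨M, hM, fun n x hx => ?_⟩
  have hfundSol := fundSol_eq_fundSolFn (k := k) c₁ (congrFun hw) u
    (add_latticeVec_ne_zero (hKs hx) n)
  exact (congrArg norm hfundSol).trans_le (hbound n x hx)

theorem contDiffOn_cot (hZ : IsHomogeneousDegreeOne fun u => Z u v) :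
    ContDiffOn ℝ ∞ (fun p : E m × E m => cot m k l c₁ Z p.1 p.2 v)
      ((lattice m l : Set (E m))ᶜ ×ˢ Set.univ) := by
  obtain ⟨w, hw⟩ := hZ.exists_linear
  exact (represents_cot hlm c₁ (congrFun hw)).contDiffOn

theorem isSpinOne_cot (hZ : IsSpinOne k fun u => Z u v) {x : E m} (hx : x ∉ lattice m l) :
    IsSpinOne k fun u => cot m k l c₁ Z x u v := by
  obtain ⟨w, hw, hrep⟩ := exists_represents_cot hlm c₁ hZ
  have hlinear : (fun u => cot m k l c₁ Z x u v) = SmoothFn.eval x ∘ₗ cotFn hlm w :=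
    funext (hrep x hx)
  rw [hlinear, isSpinOne_linear_iff]
  exact isSpinOneLinear_eval_cotFn hlm hw x

theorem opE_cot (hk : 1 ≤ k) (hZ : IsSpinOne k fun u => Z u v) {x : E m} (hx : x ∉ lattice m l)
    (u : E m) : opE m k (fun z w => cot m k l c₁ Z z w v) x u = 0 := by
  obtain ⟨w, hw, hrep⟩ := exists_represents_cot hlm c₁ hZ
  exact (hrep.opE k x hx u).trans (congrArg (SmoothFn.eval x) (higherSpin_cotFn hlm hk hw u))

end Cotangent

theorem isOpen_compl_lattice (m l : ℕ) : IsOpen ((lattice m l : Set (E m))ᶜ) :=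
  (latticeCompl (zLattice m l)).isOpen

theorem sub_notMem_lattice {m l : ℕ} {x y : E m} (h : proj m l x ≠ proj m l y) :
    x - y ∉ lattice m l := fun hxy =>
  h (QuotientAddGroup.eq_iff_sub_mem.2 hxy)

theorem mainTheorem1_general {m k l : ℕ} (hk : 1 ≤ k) (hlm : l + k + 1 ≤ m) (c₁ : ℝ)
    {Z : E m → E m → Cl m} (hZ : ∀ v, IsSpinOne k fun u => Z u v) :
    (∀ u v : E m, NormallyConvergentOn
      (fun (n : Fin l → ℤ) x => fundSol m k c₁ Z (x + latticeVec m l n) u v)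
      (lattice m l : Set (E m))ᶜ) ∧
    (∀ u v : E m, HasSumLocallyUniformlyOn
      (fun (n : Fin l → ℤ) x => fundSol m k c₁ Z (x + latticeVec m l n) u v)
      (fun x => cot m k l c₁ Z x u v) (lattice m l : Set (E m))ᶜ) ∧
    (∀ (n : Fin l → ℤ) (x u v : E m),
      cot m k l c₁ Z (x + latticeVec m l n) u v = cot m k l c₁ Z x u v) ∧
    (∀ v : E m, ContDiffOn ℝ ∞ (fun p : E m × E m => cot m k l c₁ Z p.1 p.2 v)
      ((lattice m l : Set (E m))ᶜ ×ˢ Set.univ)) ∧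
    (∀ x ∉ lattice m l, ∀ v : E m, IsSpinOne k fun u => cot m k l c₁ Z x u v) ∧
    (∀ x ∉ lattice m l, ∀ u v : E m, opE m k (fun z w => cot m k l c₁ Z z w v) x u = 0) ∧
    (∀ x y : E m, proj m l x ≠ proj m l y → ∀ u v : E m,
      HasSum (fun n : Fin l → ℤ => fundSol m k c₁ Z (x - y + latticeVec m l n) u v)
        (cotCyl m k l c₁ Z (proj m l x) (proj m l y) u v) ∧
      cotCyl m k l c₁ Z (proj m l x) (proj m l y) u v = cot m k l c₁ Z (x - y) u v) ∧
    (∀ x' y' : Cyl m l, x' ≠ y' → ∀ u v : E m,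
      opCyl m k l (fun z w => cotCyl m k l c₁ Z z y' w v) x' u = 0) := by
  have hnormal (u v : E m) := normallyConvergentOn_fundSol hlm c₁ (hZ v).1 u
  refine ⟨hnormal, fun u v => (hnormal u v).hasSumLocallyUniformlyOn (isOpen_compl_lattice m l),
    fun n x u v => cot_periodic m k l c₁ Z u v n x, fun v => contDiffOn_cot hlm c₁ (hZ v).1,
    fun x hx v => isSpinOne_cot hlm c₁ (hZ v) hx,
    fun x hx u v => opE_cot hlm c₁ hk (hZ v) hx u,
    fun x y hxy u v => ⟨((hnormal u v).summable (sub_notMem_lattice hxy)).hasSum, rfl⟩,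
    fun x' y' hxy u v => ?_⟩
  obtain ⟨x, rfl⟩ := QuotientAddGroup.mk_surjective x'
  obtain ⟨y, rfl⟩ := QuotientAddGroup.mk_surjective y'
  calc opCyl m k l (fun z w => cotCyl m k l c₁ Z z (proj m l y) w v) (proj m l x) u
      = opE m k (fun z w => cot m k l c₁ Z (z - y) w v) x u := opCyl_proj m k l _ x u
    _ = opE m k (fun z w => cot m k l c₁ Z z w v) (x - y) u :=
        opE_comp_sub m k (fun z w => cot m k l c₁ Z z w v) x y u
    _ = 0 := opE_cot hlm c₁ hk (hZ v) (sub_notMem_lattice hxy) u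

end Cylinder

end

theorem mainTheorem1 (m k l : ℕ) (hk : 1 ≤ k) (hl : 1 ≤ l) (hlm : l + k + 1 ≤ m)
    (c₁ : ℝ) (hc : c₁ ≠ 0) :
    (∃! Z : E m → E m → Cl m, IsReproducingKernel m k Z) ∧
    ∀ Z : E m → E m → Cl m, IsReproducingKernel m k Z →
      -- normal, and locally uniform, convergence on `ℝ^m \ ℤ^l`
      (∀ u v : E m, NormallyConvergentOn
        (fun (n : Fin l → ℤ) x => fundSol m k c₁ Z (x + latticeVec m l n) u v)
        (lattice m l : Set (E m))ᶜ) ∧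
      (∀ u v : E m, HasSumLocallyUniformlyOn
        (fun (n : Fin l → ℤ) x => fundSol m k c₁ Z (x + latticeVec m l n) u v)
        (fun x => cot m k l c₁ Z x u v) (lattice m l : Set (E m))ᶜ) ∧
      -- periodicity
      (∀ (n : Fin l → ℤ) (x u v : E m),
        cot m k l c₁ Z (x + latticeVec m l n) u v = cot m k l c₁ Z x u v) ∧
      -- the sum is smooth, of the right type in `u`, and annihilated by the operator on `ℝ^m`
      (∀ v : E m, ContDiffOn ℝ ∞ (fun p : E m × E m => cot m k l c₁ Z p.1 p.2 v)
        ((lattice m l : Set (E m))ᶜ ×ˢ Set.univ)) ∧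
      (∀ x ∉ lattice m l, ∀ v : E m, IsSpinOne k fun u => cot m k l c₁ Z x u v) ∧
      (∀ x ∉ lattice m l, ∀ u v : E m, opE m k (fun z w => cot m k l c₁ Z z w v) x u = 0) ∧
      -- the projected kernel is defined off the diagonal and annihilated by the operator on `C_l`
      (∀ x y : E m, proj m l x ≠ proj m l y → ∀ u v : E m,
        HasSum (fun n : Fin l → ℤ => fundSol m k c₁ Z (x - y + latticeVec m l n) u v)
          (cotCyl m k l c₁ Z (proj m l x) (proj m l y) u v) ∧
        cotCyl m k l c₁ Z (proj m l x) (proj m l y) u v = cot m k l c₁ Z (x - y) u v) ∧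
      (∀ x' y' : Cyl m l, x' ≠ y' → ∀ u v : E m,
        opCyl m k l (fun z w => cotCyl m k l c₁ Z z y' w v) x' u = 0) := by
  have : NeZero m := ⟨by omega⟩
  exact ⟨existsUnique_isReproducingKernel m k, fun _ hZ => mainTheorem1_general hk hlm c₁ hZ.mem⟩
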